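/- Fix a real-valued even function $\phi\in\mathcal S(\mathbb R)$ supported in $[-2^{-8},2^{-8}]$ with $\|\phi\|_{L^1(\mathbb R)}=1$ and $\phi(0)\neq 0$. For $v\in\mathbb S^1$, $s>0$ and $f\in\mathcal S(\mathbb R^2)$ let $$A_{v,s}f(x)=\int_{\mathbb R^2}\widehat f(\xi)\,\phi(s\,v\cdot\xi)\,e^{ix\cdot\xi}\,d\xi,\qquad \widehat f(\xi)=\frac1{(2\pi)^2}\int_{\mathbb R^2}f(y)e^{-iy\cdot\xi}\,dy,$$ and for $V\subset\mathbb S^1$, $S\subset(0,\infty)$ let $A_{V,S}f(x)=\sup_{v\in V,\,s\in S}|A_{v,s}f(x)|$ (with $\sup\emptyset=0$). Let $\|A_{V,S}\|_{L^2(\mathbb R^2)}\in[0,\infty]$ be the least $B$ such that $\|A_{V,S}f\|_2\le B\|f\|_2$ for all $f\in\mathcal S(\mathbb R^2)$. There is a constant $C$, depending only on the fixed function $\phi$, such that the following holds. Let $S\subset(0,\infty)$, let $\theta_1<\theta_2<\dots<\theta_{N+1}\le\theta_1+\pi$, and let $U=\{u_1,\dots,u_{N+1}\}\subset\mathbb S^1$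 with $u_j=(\cos\theta_j,\sin\theta_j)$. For each $j=1,\dots,N$ let $V_j\subset\mathbb S^1$ be any (possibly infinite) set of directions contained in the closed cone bordered by $u_j,u_{j+1}$, that is, $V_j\subset\{(\cos\alpha,\sin\alpha):\theta_j\le\alpha\le\theta_{j+1}\}$, and let $V=\bigcup_{j=1}^N V_j$. Then $$\|A_{V,S}\|_{L^2(\mathbb R^2)}\le C\,\|A_{U,S}\|_{L^2(\mathbb R^2)}+\max_{1\le j\le N}\|A_{V_j,S}\|_{L^2(\mathbb R^2)}.$$ -/

import Mathlib

open scoped ENNReal NNReal SchwartzMap FourierTransform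

namespace DirectionalAverages

noncomputable section

/-- The Euclidean plane. -/
abbrev Plane : Type := EuclideanSpace ℝ (Fin 2)

/-- The unit vector with polar angle `t`. -/
def dir (t : ℝ) : Plane := !₂[Real.cos t, Real.sin t]

/-- The closed arc of the unit circle swept counterclockwise from the angle `a` to the angle `b`:
the unit vectors in the closed cone bordered by `dir a` and `dir b`. -/
def arc (a b : ℝ) : Set Plane := dir '' Set.Icc a b

/-- Admissible frequency cutoffs: real valued even Schwartz functions on the line, supported in
the ball of radius `2⁻⁸`, normalized in `L¹`, and with `φ 0 ≠ 0`, so that the convolution kernels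
of the operators `avg φ v s` have nonzero mean. -/
structure IsCutoff (φ : 𝓢(ℝ, ℝ)) : Prop where
  even : ∀ t, φ (-t) = φ t
  support : tsupport (φ : ℝ → ℝ) ⊆ Metric.closedBall 0 ((2 : ℝ) ^ (-8 : ℤ))
  norm_one : ∫ t, |φ t| = 1
  zero_ne : φ 0 ≠ 0

/-- The smooth average of `f` at scale `s` along the direction `v`: the Fourier multiplier
operator with symbol `φ (s (v · ξ))` in the angular frequency `ξ`. Mathlib's Fourier transform is
in the variable `η = ξ / (2π)`, whence the factor `2π`. -/
def avg (φ : 𝓢(ℝ, ℝ)) (v : Plane) (s : ℝ) (f : 𝓢(Plane, ℂ)) (x : Plane) : ℂ :=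
  𝓕⁻ (fun η : Plane =>
    ((φ (s * (2 * Real.pi * inner ℝ v η)) : ℝ) : ℂ) * 𝓕 (f : Plane → ℂ) η) x

/-- The maximal average over the directions in `V` and the scales in `S`. -/
def maxAvg (φ : 𝓢(ℝ, ℝ)) (V : Set Plane) (S : Set ℝ) (f : 𝓢(Plane, ℂ)) (x : Plane) : ℝ≥0∞ :=
  ⨆ v ∈ V, ⨆ s ∈ S, ‖avg φ v s f x‖ₑ

/-- The `L²` operator norm of the maximal average: the least `B ∈ [0, ∞]` with
`‖A f‖₂ ≤ B ‖f‖₂` for all Schwartz functions `f`. -/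
def opNorm (φ : 𝓢(ℝ, ℝ)) (V : Set Plane) (S : Set ℝ) : ℝ≥0∞ :=
  sInf {B : ℝ≥0∞ | ∀ f : 𝓢(Plane, ℂ),
    MeasureTheory.eLpNorm (maxAvg φ V S f) 2 MeasureTheory.volume
      ≤ B * MeasureTheory.eLpNorm (f : Plane → ℂ) 2 MeasureTheory.volume}

end

end DirectionalAverages

open MeasureTheory Filter Topology

namespace DirectionalAverages

noncomputable section

/-! Let `Γ_j` be the double sector of frequencies where the linear forms of `u_j` and `u_{j+1}` have
opposite signs. For `v` in the `j`-th arc there is no cancellation in `v · ξ` when the two forms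
have the same sign, so `|u · ξ| ≤ 2 |v · ξ|` for one end `u` depending on `v` only
(`exists_end_abs_inner_le`). There a factor `χ (s u · ξ)`, with `χ = 1` on `[-2⁻⁷, 2⁻⁷]`, can be
inserted beside `φ (s v · ξ)` for free. If `f_j` is the part of `f` with frequencies in `Γ_j`, the
average of `f` along `v` is therefore that of `f_j` plus the mixed average (symbol `φ χ`) of `f`
minus that of `f_j`, up to a small error (`exists_end_enorm_avg_le`).

A linear form changes sign at most once on a half circle, so the sectors are disjoint and `∑ ‖f_j‖²
≤ ‖f‖²`. Replacing the supremum over `j` by an `ℓ²` sum then yields the largest norm over the `V_j`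
with constant one, and the mixed averages of `f` and of the `f_j` each contribute a multiple of the
norm over `U`.

For the mixed averages, write `v = a u + b e` with `e` a coordinate axis and `a` bounded. After a
shear they are dominated by a Poisson mean of `|f|` along `u` at scale `s`, followed by a Poisson
mean along one of only two axes. The latter costs a maximal function along lines, bounded on `L²` by
a `T T*` argument (`maxLineMean_bound_improves`). The former must be recovered from averages whose
kernel may change sign. In the logarithmic variable dilations are translations, the kernel has
nonzero mean because `φ 0 ≠ 0`, and averaging over all dilations with weight `exp (-ε |y|)` hardly
distorts the weight (`exists_exp_weight_le`). Dilating `S` preserves the operator norm, so the extra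
scales cost only a constant (`exists_poisson_majorant`). -/

/-- Cauchy-Schwarz for the lower Lebesgue integral. -/
theorem sq_lintegral_mul_le {α : Type*} [MeasurableSpace α] {μ : Measure α} {f g : α → ℝ≥0∞}
    (hf : AEMeasurable f μ) (hg : AEMeasurable g μ) :
    (∫⁻ a, f a * g a ∂μ) ^ 2 ≤ (∫⁻ a, f a ^ 2 ∂μ) * ∫⁻ a, g a ^ 2 ∂μ := by
  have h := ENNReal.lintegral_mul_le_Lp_mul_Lq μ Real.HolderConjugate.two_two hf hg
  calc (∫⁻ a, f a * g a ∂μ) ^ 2 ≤ _ := pow_le_pow_left' h 2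
    _ = _ := by
      rw [mul_pow, ← ENNReal.rpow_natCast, ← ENNReal.rpow_natCast, ← ENNReal.rpow_mul,
        ← ENNReal.rpow_mul]
      simp

/-- Cauchy-Schwarz with respect to a weight. -/
theorem sq_lintegral_weight_mul_le {α : Type*} [MeasurableSpace α] {μ : Measure α}
    {w g : α → ℝ≥0∞} (hw : Measurable w) (hg : Measurable g) :
    (∫⁻ a, w a * g a ∂μ) ^ 2 ≤ (∫⁻ a, w a ∂μ) * ∫⁻ a, w a * g a ^ 2 ∂μ := by
  have h := sq_lintegral_mul_le (μ := μ.withDensity w) (f := fun _ => 1) (g := g)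
    aemeasurable_const hg.aemeasurable
  simp only [one_mul, one_pow] at h
  rw [lintegral_withDensity_eq_lintegral_mul _ hw hg,
    lintegral_withDensity_eq_lintegral_mul _ hw measurable_const,
    lintegral_withDensity_eq_lintegral_mul _ hw (hg.pow_const 2)] at h
  simpa using h


/-! ### Poisson means along lines. -/

/-- The Poisson kernel of the half plane, up to the factor `π`. -/
def poisson (r t : ℝ) : ℝ≥0∞ := ENNReal.ofReal (r / (r ^ 2 + t ^ 2))

/-- The Poisson mean of `F` along the line through `x` in the direction `e`. -/
def lineMean (e : Plane) (r : ℝ) (F : Plane → ℝ≥0∞) (x : Plane) : ℝ≥0∞ :=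
  ∫⁻ t, poisson r t * F (x + t • e)

@[fun_prop]
theorem measurable_poisson (r : ℝ) : Measurable (poisson r) := by
  unfold poisson; fun_prop

theorem poisson_neg (r t : ℝ) : poisson r (-t) = poisson r t := by simp [poisson]

theorem lintegral_poisson {r : ℝ} (hr : 0 < r) : ∫⁻ t, poisson r t = ENNReal.ofReal Real.pi := by
  have h1 : ∀ t : ℝ, r / (r ^ 2 + t ^ 2) = r⁻¹ * (1 + (t / r) ^ 2)⁻¹ := by
    intro t
    field_simp
  have h2 : Integrable fun t : ℝ => r⁻¹ * (1 + (t / r) ^ 2)⁻¹ :=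
    (integrable_inv_one_add_sq.comp_div hr.ne').const_mul _
  simp only [poisson, h1]
  rw [← ofReal_integral_eq_lintegral_ofReal h2 (ae_of_all _ fun t => by positivity)]
  congr 1
  rw [integral_const_mul, Measure.integral_comp_div (fun t : ℝ => (1 + t ^ 2)⁻¹) r,
    integral_univ_inv_one_add_sq, abs_of_pos hr, smul_eq_mul, ← mul_assoc,
    inv_mul_cancel₀ hr.ne', one_mul]

/-- The reciprocal kernel `r + t² / r` satisfies a triangle inequality with constant 2, and `A⁻¹ B⁻¹
(A + B) = A⁻¹ + B⁻¹`. The radius is `max r s`, not `r + s`, so that it stays in any set of radii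
containing both. -/
theorem poisson_mul_poisson_le {r s : ℝ} (hr : 0 < r) (hs : 0 < s) (t u : ℝ) :
    poisson r t * poisson s u ≤ 2 * poisson (max r s) (t + u) * (poisson r t + poisson s u) := by
  set m := max r s with hm
  have hm0 : 0 < m := lt_max_of_lt_left hr
  have key : r / (r ^ 2 + t ^ 2) * (s / (s ^ 2 + u ^ 2)) ≤
      2 * (m / (m ^ 2 + (t + u) ^ 2)) * (r / (r ^ 2 + t ^ 2) + s / (s ^ 2 + u ^ 2)) := by
    have hA : 0 < (r ^ 2 + t ^ 2) / r := by positivity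
    have hB : 0 < (s ^ 2 + u ^ 2) / s := by positivity
    have hC : 0 < (m ^ 2 + (t + u) ^ 2) / m := by positivity
    have e1 : r / (r ^ 2 + t ^ 2) = ((r ^ 2 + t ^ 2) / r)⁻¹ := by rw [inv_div]
    have e2 : s / (s ^ 2 + u ^ 2) = ((s ^ 2 + u ^ 2) / s)⁻¹ := by rw [inv_div]
    have e3 : m / (m ^ 2 + (t + u) ^ 2) = ((m ^ 2 + (t + u) ^ 2) / m)⁻¹ := by rw [inv_div]
    have hle : (m ^ 2 + (t + u) ^ 2) / m ≤ 2 * ((r ^ 2 + t ^ 2) / r + (s ^ 2 + u ^ 2) / s) := by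
      have f1 : (m ^ 2 + (t + u) ^ 2) / m = m + (t + u) ^ 2 / m := by field_simp
      have f2 : (r ^ 2 + t ^ 2) / r = r + t ^ 2 / r := by field_simp
      have f3 : (s ^ 2 + u ^ 2) / s = s + u ^ 2 / s := by field_simp
      have g1 : m ≤ r + s := max_le (by linarith) (by linarith)
      have g2 : (t + u) ^ 2 / m ≤ (2 * t ^ 2 + 2 * u ^ 2) / m := by
        gcongr; nlinarith [sq_nonneg (t - u)]
      have g3 : t ^ 2 / m ≤ t ^ 2 / r := by gcongr; exact le_max_left _ _
      have g4 : u ^ 2 / m ≤ u ^ 2 / s := by gcongr; exact le_max_right _ _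
      have g5 : (2 * t ^ 2 + 2 * u ^ 2) / m = 2 * (t ^ 2 / m) + 2 * (u ^ 2 / m) := by ring
      rw [f1, f2, f3]; linarith
    rw [e1, e2, e3]
    set A := (r ^ 2 + t ^ 2) / r
    set B := (s ^ 2 + u ^ 2) / s
    set C := (m ^ 2 + (t + u) ^ 2) / m
    have : 2 * C⁻¹ * (A⁻¹ + B⁻¹) = (2 * (A + B)) / C * (A⁻¹ * B⁻¹) := by field_simp; ring
    rw [this]
    have h1 : 1 ≤ (2 * (A + B)) / C := by rw [le_div_iff₀ hC]; linarith
    have h2 : 0 ≤ A⁻¹ * B⁻¹ := by positivity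
    nlinarith
  unfold poisson
  have e2 : (2 : ℝ≥0∞) = ENNReal.ofReal 2 := by simp
  rw [e2, ← ENNReal.ofReal_mul (by positivity), ← ENNReal.ofReal_mul (by positivity),
    ← ENNReal.ofReal_add (by positivity) (by positivity), ← ENNReal.ofReal_mul (by positivity)]
  exact ENNReal.ofReal_le_ofReal key

@[fun_prop]
theorem measurable_lineMean (e : Plane) (r : ℝ) {F : Plane → ℝ≥0∞} (hF : Measurable F) :
    Measurable (lineMean e r F) := by
  unfold lineMean
  apply Measurable.lintegral_prod_right'
    (f := fun p : Plane × ℝ => poisson r p.2 * F (p.1 + p.2 • e))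
  fun_prop

theorem lineMean_mono (e : Plane) (r : ℝ) {F G : Plane → ℝ≥0∞} (h : F ≤ G) :
    lineMean e r F ≤ lineMean e r G := fun x =>
  lintegral_mono fun t => mul_le_mul_right (h (x + t • e)) _

theorem lineMean_finset_sum {ι : Type*} (I : Finset ι) (e : Plane) (r : ℝ)
    {F : ι → Plane → ℝ≥0∞} (hF : ∀ i ∈ I, Measurable (F i)) (x : Plane) :
    lineMean e r (fun y => ∑ i ∈ I, F i y) x = ∑ i ∈ I, lineMean e r (F i) x := by
  unfold lineMean
  simp only [Finset.mul_sum]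
  exact lintegral_finsetSum' _ fun i hi => by have := hF i hi; fun_prop

/-- Self-adjointness, from the evenness of the kernel and translation invariance. -/
theorem lintegral_mul_lineMean (e : Plane) (r : ℝ) {F G : Plane → ℝ≥0∞} (hF : Measurable F)
    (hG : Measurable G) :
    ∫⁻ x, G x * lineMean e r F x = ∫⁻ x, lineMean e r G x * F x := by
  have h1 : ∫⁻ x, G x * lineMean e r F x
      = ∫⁻ t, ∫⁻ x, poisson r t * (G x * F (x + t • e)) := by
    rw [lintegral_lintegral_swap (by fun_prop)]
    refine lintegral_congr fun x => ?_
    rw [lineMean, ← lintegral_const_mul _ (by fun_prop)]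
    exact lintegral_congr fun t => by ring
  have h2 : ∫⁻ x, lineMean e r G x * F x
      = ∫⁻ t, ∫⁻ x, poisson r t * (G (x + t • e) * F x) := by
    rw [lintegral_lintegral_swap (by fun_prop)]
    refine lintegral_congr fun x => ?_
    rw [lineMean, ← lintegral_mul_const _ (by fun_prop)]
    exact lintegral_congr fun t => by ring
  rw [h1, h2, ← lintegral_neg_eq_self (fun t => ∫⁻ x, poisson r t * (G (x + t • e) * F x))]
  refine lintegral_congr fun t => ?_
  refine Eq.trans ?_ (lintegral_add_right_eq_self _ (t • e))
  simp [poisson_neg]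

theorem lineMean_lineMean_le (e : Plane) {r s : ℝ} (hr : 0 < r) (hs : 0 < s) {F : Plane → ℝ≥0∞}
    (hF : Measurable F) (x : Plane) :
    lineMean e r (lineMean e s F) x
      ≤ ENNReal.ofReal (4 * Real.pi) * lineMean e (max r s) F x := by
  have h1 : lineMean e r (lineMean e s F) x
      = ∫⁻ u, F (x + u • e) * ∫⁻ t, poisson r t * poisson s (u - t) := by
    calc lineMean e r (lineMean e s F) x
        = ∫⁻ t, ∫⁻ u, poisson r t * (poisson s u * F (x + (u + t) • e)) := by
          refine lintegral_congr fun t => ?_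
          rw [lineMean, ← lintegral_const_mul _ (by fun_prop)]
          refine lintegral_congr fun u => ?_
          rw [add_smul, add_assoc, add_comm (u • e)]
      _ = ∫⁻ t, ∫⁻ u, poisson r t * (poisson s (u - t) * F (x + u • e)) := by
          refine lintegral_congr fun t => ?_
          refine Eq.trans ?_ (lintegral_add_right_eq_self _ t)
          simp
      _ = ∫⁻ u, ∫⁻ t, poisson r t * (poisson s (u - t) * F (x + u • e)) :=
          lintegral_lintegral_swap (by
            have := measurable_poisson s
            have h : Measurable fun p : ℝ × ℝ => poisson s (p.2 - p.1) := by fun_prop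
            fun_prop)
      _ = _ := by
          refine lintegral_congr fun u => ?_
          rw [← lintegral_const_mul _ (by fun_prop)]
          exact lintegral_congr fun t => by ring
  have h2 : ∀ u, ∫⁻ t, poisson r t * poisson s (u - t)
      ≤ ENNReal.ofReal (4 * Real.pi) * poisson (max r s) u := by
    intro u
    calc ∫⁻ t, poisson r t * poisson s (u - t)
        ≤ ∫⁻ t, 2 * poisson (max r s) u * (poisson r t + poisson s (u - t)) := by
          refine lintegral_mono fun t => ?_
          simpa using poisson_mul_poisson_le hr hs t (u - t)
      _ = 2 * poisson (max r s) u * (ENNReal.ofReal Real.pi + ENNReal.ofReal Real.pi) := by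
          rw [lintegral_const_mul _ (by fun_prop), lintegral_add_left (by fun_prop),
            lintegral_sub_left_eq_self (poisson s) u, lintegral_poisson hr, lintegral_poisson hs]
      _ = _ := by
          rw [ENNReal.ofReal_mul (by norm_num)]
          simp only [ENNReal.ofReal_ofNat]; ring
  rw [h1, lineMean, ← lintegral_const_mul _ (by fun_prop)]
  refine lintegral_mono fun u => ?_
  calc _ ≤ F (x + u • e) * (ENNReal.ofReal (4 * Real.pi) * poisson (max r s) u) := by
        gcongr; exact h2 u
    _ = _ := by ring

theorem lintegral_lineMean (e : Plane) {r : ℝ} (hr : 0 < r) {F : Plane → ℝ≥0∞}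
    (hF : Measurable F) :
    ∫⁻ x, lineMean e r F x = ENNReal.ofReal Real.pi * ∫⁻ x, F x := by
  have h := lintegral_mul_lineMean e r hF (G := fun _ => 1) measurable_const
  have h1 : lineMean e r (fun _ => 1) = fun _ => ENNReal.ofReal Real.pi := by
    ext x; simp [lineMean, lintegral_poisson hr]
  rw [h1, lintegral_const_mul _ hF] at h
  simpa using h

theorem lintegral_lineMean_sq_le (e : Plane) {r : ℝ} (hr : 0 < r) {F : Plane → ℝ≥0∞}
    (hF : Measurable F) :
    ∫⁻ x, lineMean e r F x ^ 2 ≤ ENNReal.ofReal Real.pi ^ 2 * ∫⁻ x, F x ^ 2 := by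
  calc ∫⁻ x, lineMean e r F x ^ 2
      ≤ ∫⁻ x, ENNReal.ofReal Real.pi * lineMean e r (fun y => F y ^ 2) x := by
        refine lintegral_mono fun x => ?_
        rw [← lintegral_poisson hr]
        exact sq_lintegral_weight_mul_le (by fun_prop) (by fun_prop)
    _ = _ := by
        rw [lintegral_const_mul _ (by fun_prop), lintegral_lineMean e hr (by fun_prop)]
        ring

/-! ### The maximal Poisson mean on `L²`. -/

/-- The largest Poisson mean over a finite set of radii. -/
def maxLineMean (e : Plane) (R : Finset ℝ) (F : Plane → ℝ≥0∞) (x : Plane) : ℝ≥0∞ :=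
  R.sup fun r => lineMean e r F x

@[fun_prop]
theorem measurable_maxLineMean (e : Plane) (R : Finset ℝ) {F : Plane → ℝ≥0∞}
    (hF : Measurable F) : Measurable (maxLineMean e R F) := by
  have h : maxLineMean e R F = fun x => ⨆ r ∈ R, lineMean e r F x := by
    ext x; simp [maxLineMean, Finset.sup_eq_iSup]
  rw [h]
  exact Measurable.biSup _ R.countable_toSet fun r _ => measurable_lineMean e r hF

theorem lineMean_le_maxLineMean {e : Plane} {R : Finset ℝ} {r : ℝ} (hr : r ∈ R)
    (F : Plane → ℝ≥0∞) (x : Plane) : lineMean e r F x ≤ maxLineMean e R F x :=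
  Finset.le_sup (f := fun r => lineMean e r F x) hr

/-- A crude bound growing with the number of radii. It only supplies a finite constant from which
the self-improvement can start. -/
theorem exists_bound_maxLineMean (e : Plane) {R : Finset ℝ} (hR : ∀ r ∈ R, 0 < r) :
    ∃ B : ℝ≥0, ∀ F : Plane → ℝ≥0∞, Measurable F →
      ∫⁻ x, maxLineMean e R F x ^ 2 ≤ B * ∫⁻ x, F x ^ 2 := by
  refine ⟨R.card * (Real.toNNReal Real.pi) ^ 2, fun F hF => ?_⟩
  calc ∫⁻ x, maxLineMean e R F x ^ 2 ≤ ∫⁻ x, ∑ r ∈ R, lineMean e r F x ^ 2 := by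
        refine lintegral_mono fun x => ?_
        rcases R.eq_empty_or_nonempty with rfl | hne
        · simp [maxLineMean]
        · obtain ⟨r, hr, h⟩ := R.exists_mem_eq_sup hne fun r => lineMean e r F x
          rw [maxLineMean, h]
          exact Finset.single_le_sum (f := fun r => lineMean e r F x ^ 2) (fun _ _ => zero_le) hr
    _ = ∑ r ∈ R, ∫⁻ x, lineMean e r F x ^ 2 :=
        lintegral_finsetSum' _ fun r _ => by fun_prop
    _ ≤ ∑ r ∈ R, ENNReal.ofReal Real.pi ^ 2 * ∫⁻ x, F x ^ 2 :=
        Finset.sum_le_sum fun r hr => lintegral_lineMean_sq_le e (hR r hr) hF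
    _ = _ := by
        rw [Finset.sum_const, nsmul_eq_mul, ENNReal.ofReal]; push_cast; ring

/-- A bound for the square function of the maximal Poisson mean improves itself: the largest mean
is linearized by the first radius where it is attained, and the composition of the linearization
with its adjoint is controlled by the maximal mean itself. -/
theorem maxLineMean_bound_improves (e : Plane) {R : Finset ℝ} (hR : ∀ r ∈ R, 0 < r) {B : ℝ≥0}
    (hB : ∀ F : Plane → ℝ≥0∞, Measurable F →
      ∫⁻ x, maxLineMean e R F x ^ 2 ≤ B * ∫⁻ x, F x ^ 2)
    {F : Plane → ℝ≥0∞} (hF : Measurable F) :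
    (∫⁻ x, maxLineMean e R F x ^ 2) ^ 2
      ≤ ENNReal.ofReal (8 * Real.pi) ^ 2 * B * (∫⁻ x, F x ^ 2) ^ 2 := by
  classical
  set M := maxLineMean e R F with hM
  have hMm : Measurable M := by fun_prop
  -- Ties go to the smallest radius, which makes these sets disjoint for distinct radii in `R`;
  -- hence the pieces `h r` add up to at most `M`.
  let E : ℝ → Set Plane := fun r =>
    {x | lineMean e r F x = M x ∧ ∀ q ∈ R, q < r → lineMean e q F x ≠ M x}
  have hE : ∀ r, MeasurableSet (E r) := by
    intro r
    have : E r = {x | lineMean e r F x = M x} ∩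
        ⋂ q ∈ R, ⋂ (_ : q < r), {x | lineMean e q F x = M x}ᶜ := by
      ext x; simp [E]
    rw [this]
    refine (measurableSet_eq_fun (by fun_prop) hMm).inter ?_
    refine Finset.measurableSet_biInter _ fun q _ => MeasurableSet.iInter fun _ => ?_
    exact (measurableSet_eq_fun (by fun_prop) hMm).compl
  let h : ℝ → Plane → ℝ≥0∞ := fun r => (E r).indicator M
  have hh : ∀ r, Measurable (h r) := fun r => hMm.indicator (hE r)
  have hsum : ∀ x, ∑ r ∈ R, h r x ≤ M x := by
    intro x
    by_cases hx : ∃ r ∈ R, x ∈ E r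
    · obtain ⟨r, hr, hxr⟩ := hx
      rw [Finset.sum_eq_single_of_mem r hr]
      · simp [h, hxr]
      · intro q hq hqr
        refine Set.indicator_of_notMem (fun hxq => ?_) _
        rcases lt_or_gt_of_ne hqr with hlt | hlt
        · exact hxr.2 q hq hlt hxq.1
        · exact hxq.2 r hr hlt hxr.1
    · push Not at hx
      rw [Finset.sum_eq_zero fun r hr => Set.indicator_of_notMem (hx r hr) _]
      exact zero_le
  have hsq : ∀ x, M x ^ 2 ≤ ∑ r ∈ R, h r x * lineMean e r F x := by
    intro x
    rcases R.eq_empty_or_nonempty with rfl | hne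
    · simp [hM, maxLineMean]
    · obtain ⟨q, hq, hqM⟩ := R.exists_mem_eq_sup hne fun r => lineMean e r F x
      obtain ⟨r, hr, hmin⟩ := (R.filter fun r => lineMean e r F x = M x).exists_min_image id
        ⟨q, by simp [hq, hM, maxLineMean, hqM]⟩
      rw [Finset.mem_filter] at hr
      have hxr : x ∈ E r := ⟨hr.2, fun q hq hqr hqe =>
        absurd (hmin q (by simp [hq, hqe])) (not_le.2 hqr)⟩
      calc M x ^ 2 = h r x * lineMean e r F x := by simp [h, hxr, hr.2, sq]
        _ ≤ _ := Finset.single_le_sum (f := fun r => h r x * lineMean e r F x)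
            (fun _ _ => zero_le) hr.1
  set a := ∫⁻ x, M x ^ 2 with ha
  set b := ∫⁻ x, F x ^ 2 with hb
  let W : Plane → ℝ≥0∞ := fun x => ∑ r ∈ R, lineMean e r (h r) x
  have hW : Measurable W := Finset.measurable_fun_sum _ fun r _ => measurable_lineMean e r (hh r)
  have haW : a ≤ ∫⁻ x, W x * F x := by
    calc a ≤ ∫⁻ x, ∑ r ∈ R, h r x * lineMean e r F x := lintegral_mono hsq
      _ = ∑ r ∈ R, ∫⁻ x, h r x * lineMean e r F x :=
          lintegral_finsetSum' _ fun r _ => by have := hh r; fun_prop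
      _ = ∑ r ∈ R, ∫⁻ x, lineMean e r (h r) x * F x :=
          Finset.sum_congr rfl fun r _ => lintegral_mul_lineMean e r hF (hh r)
      _ = ∫⁻ x, ∑ r ∈ R, lineMean e r (h r) x * F x :=
          (lintegral_finsetSum' _ fun r _ => by have := hh r; fun_prop).symm
      _ = _ := lintegral_congr fun x => by rw [Finset.sum_mul]
  have hdiag : ∑ r ∈ R, ∑ s ∈ R, ∫⁻ x, h r x * lineMean e r (h s) x
      ≤ ∫⁻ x, M x * maxLineMean e R M x := by
    calc ∑ r ∈ R, ∑ s ∈ R, ∫⁻ x, h r x * lineMean e r (h s) x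
        = ∑ r ∈ R, ∫⁻ x, h r x * lineMean e r (fun y => ∑ s ∈ R, h s y) x := by
          refine Finset.sum_congr rfl fun r _ => ?_
          rw [← lintegral_finsetSum' _ fun s _ => by have := hh r; have := hh s; fun_prop]
          refine lintegral_congr fun x => ?_
          rw [lineMean_finset_sum _ _ _ fun s _ => hh s, Finset.mul_sum]
      _ ≤ ∑ r ∈ R, ∫⁻ x, h r x * maxLineMean e R M x := by
          refine Finset.sum_le_sum fun r hr => lintegral_mono fun x => ?_
          exact mul_le_mul_right ((lineMean_mono e r hsum x).trans
            (lineMean_le_maxLineMean hr M x)) _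
      _ = ∫⁻ x, (∑ r ∈ R, h r x) * maxLineMean e R M x := by
          rw [← lintegral_finsetSum' _ fun s _ => by have := hh s; fun_prop]
          exact lintegral_congr fun x => by rw [Finset.sum_mul]
      _ ≤ _ := lintegral_mono fun x => mul_le_mul_left (hsum x) _
  have hWW : ∫⁻ x, W x ^ 2
      ≤ ENNReal.ofReal (8 * Real.pi) * ∫⁻ x, M x * maxLineMean e R M x := by
    -- By self-adjointness this pairs `h r` with a composition of two means, which the mean of
    -- larger radius controls. Keeping both radii on the right makes the bound symmetric in `r` and
    -- `s`.
    have hterm : ∀ r ∈ R, ∀ s ∈ R, ∫⁻ x, lineMean e r (h r) x * lineMean e s (h s) x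
        ≤ ENNReal.ofReal (4 * Real.pi) * ((∫⁻ x, h r x * lineMean e r (h s) x)
          + ∫⁻ x, h s x * lineMean e s (h r) x) := by
      intro r hr s hs
      have := hh r
      have := hh s
      rw [← lintegral_mul_lineMean e r (by fun_prop) (hh r),
        lintegral_mul_lineMean e s (hh r) (hh s)]
      rw [← lintegral_add_left (by fun_prop), ← lintegral_const_mul _ (by fun_prop)]
      refine lintegral_mono fun x => ?_
      calc h r x * lineMean e r (lineMean e s (h s)) x
          ≤ h r x * (ENNReal.ofReal (4 * Real.pi) * lineMean e (max r s) (h s) x) := by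
            gcongr; exact lineMean_lineMean_le e (hR r hr) (hR s hs) (hh s) x
        _ ≤ h r x * (ENNReal.ofReal (4 * Real.pi)
              * (lineMean e r (h s) x + lineMean e s (h s) x)) := by
            gcongr
            rcases max_choice r s with hm | hm <;> rw [hm]
            · exact le_self_add
            · exact le_add_self
        _ = _ := by ring
    calc ∫⁻ x, W x ^ 2
        = ∑ r ∈ R, ∑ s ∈ R, ∫⁻ x, lineMean e r (h r) x * lineMean e s (h s) x := by
          rw [Finset.sum_congr rfl fun r _ => (lintegral_finsetSum' R fun s _ => by
            have := hh r; have := hh s; fun_prop).symm]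
          rw [← lintegral_finsetSum' R fun r _ => by
            refine (Finset.measurable_fun_sum _ fun s _ => ?_).aemeasurable
            have := hh r; have := hh s; fun_prop]
          exact lintegral_congr fun x => by simp only [W, sq, Finset.sum_mul_sum]
      _ ≤ ∑ r ∈ R, ∑ s ∈ R, ENNReal.ofReal (4 * Real.pi) *
            ((∫⁻ x, h r x * lineMean e r (h s) x) + ∫⁻ x, h s x * lineMean e s (h r) x) :=
          Finset.sum_le_sum fun r hr => Finset.sum_le_sum fun s hs => hterm r hr s hs
      _ = ENNReal.ofReal (8 * Real.pi) *
            ∑ r ∈ R, ∑ s ∈ R, ∫⁻ x, h r x * lineMean e r (h s) x := by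
          simp only [← Finset.mul_sum, Finset.sum_add_distrib]
          rw [Finset.sum_comm (f := fun r s => ∫⁻ x, h s x * lineMean e s (h r) x), ← two_mul,
            ← mul_assoc]
          congr 1
          rw [ENNReal.ofReal_mul (by norm_num), ENNReal.ofReal_mul (by norm_num)]
          simp only [ENNReal.ofReal_ofNat]
          ring
      _ ≤ _ := by gcongr
  have hMM : (∫⁻ x, M x * maxLineMean e R M x) ^ 2 ≤ a * (B * a) :=
    (sq_lintegral_mul_le hMm.aemeasurable (by fun_prop)).trans (by gcongr; exact hB M hMm)
  have h4 : a ^ 2 * a ^ 2 ≤ a ^ 2 * (ENNReal.ofReal (8 * Real.pi) ^ 2 * B * b ^ 2) := by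
    have h2 : a ^ 2 ≤ (ENNReal.ofReal (8 * Real.pi) * ∫⁻ x, M x * maxLineMean e R M x) * b :=
      (pow_le_pow_left' haW 2).trans ((sq_lintegral_mul_le hW.aemeasurable hF.aemeasurable).trans
        (by gcongr))
    calc a ^ 2 * a ^ 2 ≤ ((ENNReal.ofReal (8 * Real.pi)
            * ∫⁻ x, M x * maxLineMean e R M x) * b) ^ 2 := by
          rw [← sq]; exact pow_le_pow_left' h2 2
      _ = ENNReal.ofReal (8 * Real.pi) ^ 2 * (∫⁻ x, M x * maxLineMean e R M x) ^ 2 * b ^ 2 := by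
          ring
      _ ≤ ENNReal.ofReal (8 * Real.pi) ^ 2 * (a * (B * a)) * b ^ 2 := by gcongr
      _ = _ := by ring
  have hab : a ≤ B * b := hB F hF
  -- Cancelling `a ^ 2` requires `a` nonzero and finite; finiteness comes from the a priori bound
  -- when `b` is finite.
  rcases eq_or_ne a 0 with ha0 | ha0
  · simp [ha0]
  rcases eq_or_ne b ∞ with hbt | hbt
  · have hB0 : B ≠ 0 := by
      rintro rfl
      simp at hab
      exact ha0 hab
    have : ENNReal.ofReal (8 * Real.pi) ≠ 0 := by simp [Real.pi_pos]
    rw [hbt, ENNReal.top_pow two_ne_zero, ENNReal.mul_top]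
    · exact le_top
    · exact mul_ne_zero (pow_ne_zero _ this) (by exact_mod_cast hB0)
  · have hat : a ≠ ∞ := ne_top_of_le_ne_top (ENNReal.mul_ne_top ENNReal.coe_ne_top hbt) hab
    exact (ENNReal.mul_le_mul_iff_right (pow_ne_zero 2 ha0) (ENNReal.pow_ne_top hat)).1 h4

/-- The `L²` bound for the maximal Poisson mean, uniform over finite sets of radii. -/
theorem lintegral_maxLineMean_sq_le (e : Plane) {R : Finset ℝ} (hR : ∀ r ∈ R, 0 < r)
    {F : Plane → ℝ≥0∞} (hF : Measurable F) :
    ∫⁻ x, maxLineMean e R F x ^ 2 ≤ ENNReal.ofReal (65 * Real.pi ^ 2) * ∫⁻ x, F x ^ 2 := by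
  let 𝓑 : Set ℝ := {B | 0 ≤ B ∧ ∀ F : Plane → ℝ≥0∞, Measurable F →
      ∫⁻ x, maxLineMean e R F x ^ 2 ≤ ENNReal.ofReal B * ∫⁻ x, F x ^ 2}
  have hne : 𝓑.Nonempty := by
    obtain ⟨B, hB⟩ := exists_bound_maxLineMean e hR
    exact ⟨B, B.2, by simpa using hB⟩
  have hbdd : BddBelow 𝓑 := ⟨0, fun B hB => hB.1⟩
  -- The fixed point of this map is `64 π²`, so the infimum of the admissible constants cannot
  -- exceed it. The stated 65 leaves room for an admissible constant near the infimum, which need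
  -- not be attained.
  have himp : ∀ B ∈ 𝓑, 8 * Real.pi * √B ∈ 𝓑 := by
    intro B hB
    refine ⟨by positivity, fun F hF => ?_⟩
    have h := maxLineMean_bound_improves e hR (B := B.toNNReal) hB.2 hF
    rw [← ENNReal.pow_le_pow_left_iff two_ne_zero]
    refine h.trans_eq ?_
    rw [mul_pow, ← ENNReal.ofReal_pow (by positivity), ← ENNReal.ofReal_pow (by positivity),
      mul_pow _ √B, Real.sq_sqrt hB.1, ENNReal.ofReal_mul (by positivity)]
    rfl
  set β := sInf 𝓑 with hβ
  have hβ0 : 0 ≤ β := Real.sInf_nonneg fun B hB => hB.1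
  have hβB : ∀ B ∈ 𝓑, β ^ 2 / (64 * Real.pi ^ 2) ≤ B := by
    intro B hB
    have h1 : β ≤ 8 * Real.pi * √B := csInf_le hbdd (himp B hB)
    rw [div_le_iff₀ (by positivity)]
    calc β ^ 2 ≤ (8 * Real.pi * √B) ^ 2 := by gcongr
      _ = _ := by rw [mul_pow, Real.sq_sqrt hB.1]; ring
  have hββ : β ^ 2 / (64 * Real.pi ^ 2) ≤ β := le_csInf hne hβB
  have hlt : β < 65 * Real.pi ^ 2 := by
    rw [div_le_iff₀ (by positivity)] at hββ
    have hpi : 0 < Real.pi ^ 2 := by positivity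
    by_contra hcon
    push Not at hcon
    nlinarith
  obtain ⟨B, hB, hBlt⟩ := exists_lt_of_csInf_lt hne hlt
  exact (hB.2 F hF).trans (by gcongr)

/-- The maximal Poisson mean over the dyadic radii. -/
def dyadicMean (e : Plane) (F : Plane → ℝ≥0∞) (x : Plane) : ℝ≥0∞ :=
  ⨆ k : ℤ, lineMean e ((2 : ℝ) ^ k) F x

@[fun_prop]
theorem measurable_dyadicMean (e : Plane) {F : Plane → ℝ≥0∞} (hF : Measurable F) :
    Measurable (dyadicMean e F) :=
  Measurable.iSup fun _ => measurable_lineMean e _ hF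

theorem lintegral_dyadicMean_sq_le (e : Plane) {F : Plane → ℝ≥0∞} (hF : Measurable F) :
    ∫⁻ x, dyadicMean e F x ^ 2 ≤ ENNReal.ofReal (65 * Real.pi ^ 2) * ∫⁻ x, F x ^ 2 := by
  classical
  let R : ℕ → Finset ℝ := fun n => (Finset.Icc (-(n : ℤ)) n).image fun k => (2 : ℝ) ^ k
  have hR : ∀ n, ∀ r ∈ R n, 0 < r := by
    intro n r hr
    obtain ⟨k, -, rfl⟩ := Finset.mem_image.1 hr
    positivity
  have hmono : Monotone R := fun m n hmn =>
    Finset.image_subset_image (Finset.Icc_subset_Icc (by omega) (by omega))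
  have hMmono : ∀ x, Monotone fun n => maxLineMean e (R n) F x := fun x m n hmn =>
    Finset.sup_mono (hmono hmn)
  have hle : ∀ x, dyadicMean e F x ≤ ⨆ n, maxLineMean e (R n) F x := by
    refine fun x => iSup_le fun k => le_iSup_of_le k.natAbs ?_
    refine lineMean_le_maxLineMean (Finset.mem_image.2 ⟨k, ?_, rfl⟩) F x
    rw [Finset.mem_Icc]; omega
  calc ∫⁻ x, dyadicMean e F x ^ 2 ≤ ∫⁻ x, ⨆ n, maxLineMean e (R n) F x ^ 2 := by
        refine lintegral_mono fun x => ?_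
        calc dyadicMean e F x ^ 2 ≤ (⨆ n, maxLineMean e (R n) F x) ^ 2 :=
              pow_le_pow_left' (hle x) 2
          _ = _ := ENNReal.iSup_pow _ _
    _ = ⨆ n, ∫⁻ x, maxLineMean e (R n) F x ^ 2 := by
        refine lintegral_iSup (fun n => by fun_prop) fun m n hmn x => ?_
        exact pow_le_pow_left' (hMmono x hmn) 2
    _ ≤ _ := iSup_le fun n => lintegral_maxLineMean_sq_le e (hR n) hF

/-- Rounding the radius down to a power of 2 loses at most a factor 2 in the kernel. -/
theorem lineMean_le_dyadicMean (e : Plane) {r : ℝ} (hr : 0 < r) (F : Plane → ℝ≥0∞) (x : Plane) :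
    lineMean e r F x ≤ 2 * dyadicMean e F x := by
  obtain ⟨k, hk1, hk2⟩ := exists_mem_Ico_zpow (y := (2 : ℝ)) hr (by norm_num)
  set q := (2 : ℝ) ^ k with hq
  have hq0 : 0 < q := by positivity
  have hr2 : r ≤ 2 * q := by rw [zpow_add_one₀ (by norm_num)] at hk2; linarith
  have h : ∀ t, poisson r t ≤ 2 * poisson q t := by
    intro t
    unfold poisson
    rw [show (2 : ℝ≥0∞) = ENNReal.ofReal 2 by simp, ← ENNReal.ofReal_mul (by positivity)]
    refine ENNReal.ofReal_le_ofReal ?_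
    rw [← mul_div_assoc, div_le_div_iff₀ (by positivity) (by positivity)]
    nlinarith [mul_nonneg (sub_nonneg.2 hr2) (sq_nonneg t), mul_pos hr hq0,
      mul_nonneg (mul_pos hr hq0).le (sub_nonneg.2 hk1)]
  calc lineMean e r F x ≤ ∫⁻ t, 2 * (poisson q t * F (x + t • e)) :=
        lintegral_mono fun t => by
          rw [← mul_assoc]; exact mul_le_mul_left (h t) _
    _ = 2 * lineMean e q F x := lintegral_const_mul' _ _ (by simp)
    _ ≤ _ := by gcongr; exact le_iSup (fun k : ℤ => lineMean e ((2 : ℝ) ^ k) F x) k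

/-! ### The multiplier operators as averages along lines. -/

/-- A multiplier depending on one linear form acts by averaging along a line. -/
theorem fourierInv_line_mul (ψ : 𝓢(ℝ, ℂ)) (w : Plane) {F : Plane → ℂ} (hF : Integrable F)
    (x : Plane) :
    𝓕⁻ (fun η : Plane => ψ (inner ℝ w η) * F η) x = ∫ t, 𝓕 ψ t * 𝓕⁻ F (x + t • w) := by
  have hψ : ∀ τ, ψ τ = ∫ t, Complex.exp (↑(2 * Real.pi * (t * τ)) * Complex.I) * 𝓕 ψ t := by
    intro τ
    have h : 𝓕⁻ (𝓕 ψ) τ = ψ τ := by simp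
    rw [← h, SchwartzMap.fourierInv_coe, Real.fourierInv_eq']
    simp [mul_comm]
  have hint : Integrable (fun p : Plane × ℝ =>
      Complex.exp (↑(2 * Real.pi * inner ℝ p.1 (x + p.2 • w)) * Complex.I)
        * (F p.1 * 𝓕 ψ p.2)) (volume.prod volume) := by
    refine (hF.mul_prod (𝓕 ψ).integrable).bdd_mul (c := 1) ?_ ?_
    · exact (by fun_prop : Continuous _).aestronglyMeasurable
    · exact ae_of_all _ fun p => (Complex.norm_exp_ofReal_mul_I _).le
  have h1 : 𝓕⁻ (fun η : Plane => ψ (inner ℝ w η) * F η) x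
      = ∫ η, ∫ t, Complex.exp (↑(2 * Real.pi * inner ℝ η (x + t • w)) * Complex.I)
        * (F η * 𝓕 ψ t) := by
    rw [Real.fourierInv_eq']
    refine integral_congr_ae (ae_of_all _ fun η => ?_)
    simp only [smul_eq_mul]
    rw [hψ, ← integral_mul_const, ← integral_const_mul]
    refine integral_congr_ae (ae_of_all _ fun t => ?_)
    simp only
    rw [inner_add_right, inner_smul_right, mul_add, Complex.ofReal_add, add_mul, Complex.exp_add,
      real_inner_comm w η]
    ring
  rw [h1, integral_integral_swap hint]
  refine integral_congr_ae (ae_of_all _ fun t => ?_)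
  simp only
  rw [Real.fourierInv_eq', ← integral_const_mul]
  refine integral_congr_ae (ae_of_all _ fun η => ?_)
  simp only [smul_eq_mul]
  ring

theorem integrable_line_mul (ψ : 𝓢(ℝ, ℂ)) (w : Plane) {F : Plane → ℂ} (hF : Integrable F) :
    Integrable fun η : Plane => ψ (inner ℝ w η) * F η := by
  refine hF.bdd_mul (c := SchwartzMap.seminorm ℝ 0 0 ψ) ?_ ?_
  · exact (ψ.continuous.comp (by fun_prop)).aestronglyMeasurable
  · exact ae_of_all _ fun η => SchwartzMap.norm_le_seminorm ℝ ψ _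

/-- A real Schwartz function as a complex valued one. -/
def toComplex (φ : 𝓢(ℝ, ℝ)) : 𝓢(ℝ, ℂ) := SchwartzMap.postcompCLM Complex.ofRealCLM φ

@[simp]
theorem toComplex_apply (φ : 𝓢(ℝ, ℝ)) (t : ℝ) : toComplex φ t = (φ t : ℂ) := rfl

theorem scaled_inner (v η : Plane) (s : ℝ) :
    s * (2 * Real.pi * inner ℝ v η) = inner ℝ ((2 * Real.pi * s) • v) η := by
  rw [real_inner_smul_left]; ring

theorem avg_eq_integral (φ : 𝓢(ℝ, ℝ)) (v : Plane) (s : ℝ) (f : 𝓢(Plane, ℂ)) (x : Plane) :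
    avg φ v s f x = ∫ t, 𝓕 (toComplex φ) t * f (x + t • (2 * Real.pi * s) • v) := by
  have hf : 𝓕⁻ (𝓕 (f : Plane → ℂ)) = f := by
    rw [← SchwartzMap.fourier_coe, ← SchwartzMap.fourierInv_coe]; simp
  have h := fourierInv_line_mul (toComplex φ) ((2 * Real.pi * s) • v)
    (F := 𝓕 (f : Plane → ℂ)) (𝓕 f).integrable x
  rw [hf] at h
  rw [← h, avg]
  simp only [scaled_inner, toComplex_apply]

/-- The multiplier operator with symbol `φ (s (v · ξ)) χ (s (u · ξ))`. -/
def mixedAvg (φ χ : 𝓢(ℝ, ℝ)) (u v : Plane) (s : ℝ) (f : 𝓢(Plane, ℂ)) (x : Plane) : ℂ :=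
  𝓕⁻ (fun η : Plane => ((φ (s * (2 * Real.pi * inner ℝ v η)) : ℝ) : ℂ) *
    (((χ (s * (2 * Real.pi * inner ℝ u η)) : ℝ) : ℂ) * 𝓕 (f : Plane → ℂ) η)) x

theorem mixedAvg_eq_integral (φ χ : 𝓢(ℝ, ℝ)) (u v : Plane) (s : ℝ) (f : 𝓢(Plane, ℂ))
    (x : Plane) :
    mixedAvg φ χ u v s f x = ∫ t, 𝓕 (toComplex φ) t *
      ∫ q, 𝓕 (toComplex χ) q
        * f (x + t • (2 * Real.pi * s) • v + q • (2 * Real.pi * s) • u) := by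
  have h := fourierInv_line_mul (toComplex φ) ((2 * Real.pi * s) • v)
    (integrable_line_mul (toComplex χ) ((2 * Real.pi * s) • u)
      (F := 𝓕 (f : Plane → ℂ)) (𝓕 f).integrable) x
  simp only [← avg_eq_integral]
  simp only [← scaled_inner, toComplex_apply] at h
  exact h

theorem continuous_avg_exp (φ : 𝓢(ℝ, ℝ)) (v : Plane) (s : ℝ) (f : 𝓢(Plane, ℂ)) :
    Continuous fun p : ℝ × Plane => avg φ v (Real.exp p.1 * s) f p.2 := by
  simp only [avg_eq_integral]
  refine continuous_of_dominated
    (bound := fun t => ‖𝓕 (toComplex φ) t‖ * SchwartzMap.seminorm ℝ 0 0 f) ?_ ?_ ?_ ?_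
  · intro p
    exact ((𝓕 (toComplex φ)).continuous.mul
      (f.continuous.comp (by fun_prop))).aestronglyMeasurable
  · intro p
    refine ae_of_all _ fun t => ?_
    rw [norm_mul]
    gcongr
    exact SchwartzMap.norm_le_seminorm ℝ f _
  · exact ((𝓕 (toComplex φ)).integrable.norm).mul_const _
  · exact ae_of_all _ fun t => continuous_const.mul (f.continuous.comp (by fun_prop))

/-! ### Dilation invariance of the maximal average. -/

/-- The maximal average over the scales in the dilate of `S` by the factor `exp y`. -/
def dilMaxAvg (φ : 𝓢(ℝ, ℝ)) (V : Set Plane) (S : Set ℝ) (f : 𝓢(Plane, ℂ)) (y : ℝ) (x : Plane) :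
    ℝ≥0∞ :=
  ⨆ v ∈ V, ⨆ s ∈ S, ‖avg φ v (Real.exp y * s) f x‖ₑ

/-- The suprema may be uncountable, but a supremum of continuous functions is lower semicontinuous.
-/
theorem measurable_dilMaxAvg (φ : 𝓢(ℝ, ℝ)) (V : Set Plane) (S : Set ℝ) (f : 𝓢(Plane, ℂ)) :
    Measurable fun p : ℝ × Plane => dilMaxAvg φ V S f p.1 p.2 := by
  refine LowerSemicontinuous.measurable ?_
  refine lowerSemicontinuous_biSup fun v _ => lowerSemicontinuous_biSup fun s _ => ?_
  exact (continuous_avg_exp φ v s f).enorm.lowerSemicontinuous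

theorem measurable_maxAvg (φ : 𝓢(ℝ, ℝ)) (V : Set Plane) (S : Set ℝ) (f : 𝓢(Plane, ℂ)) :
    Measurable (maxAvg φ V S f) := by
  have h := (measurable_dilMaxAvg φ V S f).comp (measurable_prodMk_left (x := (0 : ℝ)))
  have h2 : maxAvg φ V S f = fun x => dilMaxAvg φ V S f 0 x := by
    ext x; simp [maxAvg, dilMaxAvg]
  rw [h2]; exact h

/-- The dilate `f (c x)` of a Schwartz function. -/
def dilate (c : ℝˣ) (f : 𝓢(Plane, ℂ)) : 𝓢(Plane, ℂ) :=
  SchwartzMap.compCLMOfContinuousLinearEquiv ℝ (ContinuousLinearEquiv.smulLeft c) f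

@[simp]
theorem dilate_apply (c : ℝˣ) (f : 𝓢(Plane, ℂ)) (x : Plane) : dilate c f x = f ((c : ℝ) • x) := rfl

theorem lintegral_comp_smul_plane {c : ℝ} (hc : c ≠ 0) {F : Plane → ℝ≥0∞} (hF : Measurable F) :
    ∫⁻ x, F (c • x) = ENNReal.ofReal |(c ^ 2)⁻¹| * ∫⁻ x, F x := by
  rw [← lintegral_map hF (measurable_const_smul c), Measure.map_addHaar_smul _ hc,
    lintegral_smul_measure]
  simp [Plane]

theorem dilMaxAvg_eq (φ : 𝓢(ℝ, ℝ)) (V : Set Plane) (S : Set ℝ) (f : 𝓢(Plane, ℂ)) (y : ℝ)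
    (x : Plane) :
    dilMaxAvg φ V S f y x
      = maxAvg φ V S (dilate (Units.mk0 (Real.exp y) (Real.exp_ne_zero y)) f)
          ((Real.exp y)⁻¹ • x) := by
  have h : ∀ v s, avg φ v (Real.exp y * s) f x
      = avg φ v s (dilate (Units.mk0 (Real.exp y) (Real.exp_ne_zero y)) f)
          ((Real.exp y)⁻¹ • x) := by
    intro v s
    simp only [avg_eq_integral, dilate_apply, Units.val_mk0]
    refine integral_congr_ae (ae_of_all _ fun t => ?_)
    simp only
    congr 2
    rw [smul_add, smul_inv_smul₀ (Real.exp_ne_zero y)]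
    simp only [smul_smul]
    congr 2
    ring
  simp only [dilMaxAvg, maxAvg, h]

/-- Dilations preserve the `L²` bounds of the maximal average. -/
theorem lintegral_dilMaxAvg_sq_le {φ : 𝓢(ℝ, ℝ)} {V : Set Plane} {S : Set ℝ} {A : ℝ≥0∞}
    (hA : ∀ f : 𝓢(Plane, ℂ), ∫⁻ x, maxAvg φ V S f x ^ 2 ≤ A * ∫⁻ x, ‖f x‖ₑ ^ 2)
    (f : 𝓢(Plane, ℂ)) (y : ℝ) :
    ∫⁻ x, dilMaxAvg φ V S f y x ^ 2 ≤ A * ∫⁻ x, ‖f x‖ₑ ^ 2 := by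
  set c := Units.mk0 (Real.exp y) (Real.exp_ne_zero y) with hc
  have hc0 : (c : ℝ) ≠ 0 := c.ne_zero
  have hfm : Measurable fun x => ‖f x‖ₑ ^ 2 := by
    have := f.continuous.measurable; fun_prop
  calc ∫⁻ x, dilMaxAvg φ V S f y x ^ 2
      = ∫⁻ x, maxAvg φ V S (dilate c f) ((c : ℝ)⁻¹ • x) ^ 2 :=
        lintegral_congr fun x => by rw [dilMaxAvg_eq]; rfl
    _ = ENNReal.ofReal |(((c : ℝ)⁻¹) ^ 2)⁻¹| * ∫⁻ x, maxAvg φ V S (dilate c f) x ^ 2 :=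
        lintegral_comp_smul_plane (inv_ne_zero hc0) ((measurable_maxAvg _ _ _ _).pow_const 2)
    _ ≤ ENNReal.ofReal |(((c : ℝ)⁻¹) ^ 2)⁻¹| * (A * ∫⁻ x, ‖dilate c f x‖ₑ ^ 2) := by
        gcongr; exact hA _
    _ = ENNReal.ofReal |(((c : ℝ)⁻¹) ^ 2)⁻¹|
          * (A * (ENNReal.ofReal |((c : ℝ) ^ 2)⁻¹| * ∫⁻ x, ‖f x‖ₑ ^ 2)) := by
        rw [← lintegral_comp_smul_plane hc0 hfm]; rfl
    _ = (ENNReal.ofReal |(((c : ℝ)⁻¹) ^ 2)⁻¹| * ENNReal.ofReal |((c : ℝ) ^ 2)⁻¹|)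
          * (A * ∫⁻ x, ‖f x‖ₑ ^ 2) := by ring
    _ = _ := by
        rw [← ENNReal.ofReal_mul (abs_nonneg _), ← abs_mul]
        have : (((c : ℝ)⁻¹) ^ 2)⁻¹ * ((c : ℝ) ^ 2)⁻¹ = 1 := by field_simp
        rw [this]; simp

/-! ### Recovering Poisson means from averages over dilations. -/

theorem integral_exp_neg_mul_abs {a : ℝ} (ha : 0 < a) : ∫ z : ℝ, Real.exp (-(a * |z|)) = 2 / a := by
  rw [integral_comp_abs (f := fun z => Real.exp (-(a * z)))]
  have h := integral_exp_mul_Ioi (neg_lt_zero.2 ha) 0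
  simp only [neg_mul] at h
  rw [h]
  simp
  ring

theorem integrable_exp_neg_mul_abs {a : ℝ} (ha : 0 < a) :
    Integrable fun z : ℝ => Real.exp (-(a * |z|)) := by
  refine Integrable.of_integral_ne_zero ?_
  rw [integral_exp_neg_mul_abs ha]
  positivity

/-- Averaging the convolutions with an integrable kernel of nonzero mean against a slowly decaying
exponential weight dominates the weight itself. -/
theorem exists_exp_weight_le {κ : ℝ → ℂ} (hκ : Continuous κ) {C : ℝ}
    (hC : ∀ z, ‖κ z‖ ≤ C * Real.exp (-|z|)) (h0 : ∫ z, κ z ≠ 0) :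
    ∃ ε : ℝ, 0 < ε ∧ ε < 1 ∧ ∃ c : ℝ≥0, ∀ (G : ℝ → ℝ) (M : ℝ), Continuous G → (∀ y, 0 ≤ G y) →
      (∀ y, G y ≤ M) →
      ∫⁻ y, ENNReal.ofReal (Real.exp (-(ε * |y|)) * G y)
        ≤ c * ∫⁻ y, ENNReal.ofReal (Real.exp (-(ε * |y|))) * ‖∫ z, κ z * G (y + z)‖ₑ := by
  set b := ‖∫ z, κ z‖ with hb
  have hb0 : 0 < b := norm_pos_iff.2 h0
  have hC0 : 0 ≤ C := by
    have := (norm_nonneg _).trans (hC 0)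
    simpa using this
  -- Chosen so that the error `C (2 / (1 - ε) - 2)` equals `C b / (2 (C + 1))`, at most half of the
  -- main term `b`.
  set ε := b / (4 * (C + 1) + b) with hε
  have hε0 : 0 < ε := by positivity
  have hε1 : ε < 1 := by rw [hε, div_lt_one (by positivity)]; linarith
  have hκi : Integrable κ := by
    refine Integrable.mono' ((integrable_exp_neg_mul_abs one_pos).const_mul C)
      hκ.aestronglyMeasurable (ae_of_all _ fun z => ?_)
    simpa using hC z
  have hκC : ∀ z, ‖κ z‖ * Real.exp (ε * |z|) ≤ C * Real.exp (-((1 - ε) * |z|)) := by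
    intro z
    calc ‖κ z‖ * Real.exp (ε * |z|) ≤ C * Real.exp (-|z|) * Real.exp (ε * |z|) := by
          gcongr; exact hC z
      _ = _ := by rw [mul_assoc, ← Real.exp_add]; congr 2; ring
  refine ⟨ε, hε0, hε1, Real.toNNReal (2 / b), fun G M hG hG0 hGM => ?_⟩
  have hM : ∀ y, ‖(G y : ℂ)‖ ≤ M := fun y => by
    rw [Complex.norm_real, Real.norm_of_nonneg (hG0 y)]; exact hGM y
  set w : ℝ → ℝ := fun y => Real.exp (-(ε * |y|)) with hw
  have hwi : Integrable w := integrable_exp_neg_mul_abs hε0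
  have hwG : Integrable fun y => w y * G y := by
    refine hwi.mul_bdd (c := M) hG.aestronglyMeasurable (ae_of_all _ fun y => ?_)
    rw [Real.norm_of_nonneg (hG0 y)]; exact hGM y
  have hwsub : ∀ y z, w (y - z) ≤ w y * Real.exp (ε * |z|) := by
    intro y z
    rw [hw, ← Real.exp_add]
    refine Real.exp_le_exp.2 ?_
    have : |y| ≤ |y - z| + |z| := by simpa using abs_add_le (y - z) z
    nlinarith
  have hwsub' : ∀ y z, w y * Real.exp (-(ε * |z|)) ≤ w (y - z) := by
    intro y z
    rw [hw, ← Real.exp_add]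
    refine Real.exp_le_exp.2 ?_
    have : |y - z| ≤ |y| + |z| := abs_sub y z
    nlinarith
  -- Fubini moves the convolution from `G` onto the slowly varying weight, where `κ` acts almost as
  -- multiplication by its mean.
  set L : ℝ → ℂ := fun y => ∫ z, κ z * w (y - z) with hL
  have hprod1 : Integrable (fun p : ℝ × ℝ => ((w p.1 : ℂ) * κ p.2) * G (p.1 + p.2))
      (volume.prod volume) := by
    refine (hwi.ofReal.mul_prod hκi).mul_bdd (c := M) ?_ (ae_of_all _ fun p => hM _)
    exact (by fun_prop : Continuous _).aestronglyMeasurable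
  have hprod2 : Integrable (fun p : ℝ × ℝ => (G p.1 : ℂ) * (κ p.2 * w (p.1 - p.2)))
      (volume.prod volume) := by
    have hdom := (hwG.mul_prod ((integrable_exp_neg_mul_abs (sub_pos.2 hε1)).const_mul C))
    refine hdom.mono' (by fun_prop : Continuous _).aestronglyMeasurable (ae_of_all _ fun p => ?_)
    rw [norm_mul, norm_mul, Complex.norm_real, Complex.norm_real, Real.norm_of_nonneg (hG0 _),
      Real.norm_of_nonneg (Real.exp_nonneg _)]
    calc G p.1 * (‖κ p.2‖ * w (p.1 - p.2))
        ≤ G p.1 * (‖κ p.2‖ * (w p.1 * Real.exp (ε * |p.2|))) := by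
          have := hG0 p.1
          gcongr; exact hwsub _ _
      _ = w p.1 * G p.1 * (‖κ p.2‖ * Real.exp (ε * |p.2|)) := by ring
      _ ≤ _ := by
          exact mul_le_mul_of_nonneg_left (hκC _) (mul_nonneg (Real.exp_nonneg _) (hG0 _))
  have hI : ∫ y, (w y : ℂ) * ∫ z, κ z * G (y + z) = ∫ y, (G y : ℂ) * L y := by
    calc ∫ y, (w y : ℂ) * ∫ z, κ z * G (y + z)
        = ∫ y, ∫ z, ((w y : ℂ) * κ z) * G (y + z) := by
          refine integral_congr_ae (ae_of_all _ fun y => ?_)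
          simp only [← integral_const_mul, mul_assoc]
      _ = ∫ z, ∫ y, ((w y : ℂ) * κ z) * G (y + z) := integral_integral_swap hprod1
      _ = ∫ z, ∫ y, (G y : ℂ) * (κ z * w (y - z)) := by
          refine integral_congr_ae (ae_of_all _ fun z => ?_)
          simp only
          rw [← integral_add_right_eq_self (fun y => (G y : ℂ) * (κ z * w (y - z))) z]
          refine integral_congr_ae (ae_of_all _ fun y => ?_)
          simp only [add_sub_cancel_right]; ring
      _ = ∫ y, ∫ z, (G y : ℂ) * (κ z * w (y - z)) := (integral_integral_swap hprod2).symm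
      _ = _ := by
          refine integral_congr_ae (ae_of_all _ fun y => ?_)
          simp only [hL, ← integral_const_mul]
  have hLi : Integrable fun y => (G y : ℂ) * L y := by
    have := hprod2.integral_prod_left
    simpa only [integral_const_mul] using this
  have hLerr : ∀ y, ‖L y - (∫ z, κ z) * w y‖ ≤ b / 2 * w y := by
    intro y
    have hi1 : Integrable fun z => κ z * (w (y - z) : ℂ) := by
      refine hκi.mul_bdd (c := 1) (by fun_prop : Continuous _).aestronglyMeasurable
        (ae_of_all _ fun z => ?_)
      rw [Complex.norm_real, Real.norm_of_nonneg (Real.exp_nonneg _), Real.exp_le_one_iff]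
      have := abs_nonneg (y - z)
      nlinarith
    have hdom : Integrable fun z => w y * (C * Real.exp (-((1 - ε) * |z|))
        - C * Real.exp (-(1 * |z|))) :=
      (((integrable_exp_neg_mul_abs (sub_pos.2 hε1)).const_mul C).sub
        ((integrable_exp_neg_mul_abs one_pos).const_mul C)).const_mul _
    have hpt : ∀ z, ‖κ z * (w (y - z) : ℂ) - κ z * (w y : ℂ)‖
        ≤ w y * (C * Real.exp (-((1 - ε) * |z|)) - C * Real.exp (-(1 * |z|))) := by
      intro z
      have hy0 : 0 < w y := Real.exp_pos _
      have h1 : |w (y - z) - w y| ≤ w y * (Real.exp (ε * |z|) - 1) := by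
        -- This bounds the possible decrease of the weight by its possible increase, so one estimate
        -- serves both signs.
        have h3 : 2 ≤ Real.exp (ε * |z|) + Real.exp (-(ε * |z|)) := by
          have h4 := Real.add_one_le_exp (ε * |z|)
          have h5 := Real.add_one_le_exp (-(ε * |z|))
          linarith
        rw [abs_le]
        constructor
        · nlinarith [hwsub' y z]
        · nlinarith [hwsub y z]
      rw [← mul_sub, norm_mul, ← Complex.ofReal_sub, Complex.norm_real, Real.norm_eq_abs]
      calc ‖κ z‖ * |w (y - z) - w y| ≤ (C * Real.exp (-|z|)) * (w y * (Real.exp (ε * |z|) - 1)) := by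
            gcongr; exact hC z
        _ = w y * (C * (Real.exp (-|z|) * Real.exp (ε * |z|)) - C * Real.exp (-|z|)) := by ring
        _ = _ := by
            rw [← Real.exp_add, one_mul]; congr 4; ring
    calc ‖L y - (∫ z, κ z) * w y‖ = ‖∫ z, (κ z * (w (y - z) : ℂ) - κ z * (w y : ℂ))‖ := by
          rw [integral_sub hi1 (hκi.mul_const _), integral_mul_const]
      _ ≤ ∫ z, w y * (C * Real.exp (-((1 - ε) * |z|)) - C * Real.exp (-(1 * |z|))) :=
          norm_integral_le_of_norm_le hdom (ae_of_all _ hpt)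
      _ = w y * (C * (2 / (1 - ε)) - C * (2 / 1)) := by
          rw [integral_const_mul, integral_sub
            ((integrable_exp_neg_mul_abs (sub_pos.2 hε1)).const_mul C)
            ((integrable_exp_neg_mul_abs one_pos).const_mul C), integral_const_mul,
            integral_const_mul, integral_exp_neg_mul_abs (sub_pos.2 hε1),
            integral_exp_neg_mul_abs one_pos]
      _ ≤ w y * (b / 2) := by
          gcongr
          have h1 : 1 - ε = 4 * (C + 1) / (4 * (C + 1) + b) := by rw [hε]; field_simp; ring
          rw [h1]
          have h2 : C * (2 / (4 * (C + 1) / (4 * (C + 1) + b))) - C * (2 / 1)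
              = C * b / (2 * (C + 1)) := by field_simp; ring
          rw [h2, div_le_div_iff₀ (by positivity) (by norm_num)]
          nlinarith
      _ = _ := mul_comm _ _
  set W := ∫ y, w y * G y with hW
  have hW0 : 0 ≤ W := integral_nonneg fun y => mul_nonneg (Real.exp_nonneg _) (hG0 y)
  have hdiff : ‖(∫ y, (G y : ℂ) * L y) - (∫ z, κ z) * W‖ ≤ b / 2 * W := by
    have h1 : (∫ z, κ z) * (W : ℂ) = ∫ y, (∫ z, κ z) * ((w y * G y : ℝ) : ℂ) := by
      rw [integral_const_mul, integral_complex_ofReal]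
    have hwGc : Integrable fun y => ((w y * G y : ℝ) : ℂ) := hwG.ofReal
    rw [h1, ← integral_sub hLi (hwGc.const_mul _), hW, ← integral_const_mul]
    refine norm_integral_le_of_norm_le (hwG.const_mul _) (ae_of_all _ fun y => ?_)
    have h2 : (G y : ℂ) * L y - (∫ z, κ z) * ((w y * G y : ℝ) : ℂ)
        = (G y : ℂ) * (L y - (∫ z, κ z) * w y) := by push_cast; ring
    rw [h2, norm_mul, Complex.norm_real, Real.norm_of_nonneg (hG0 y)]
    calc G y * ‖L y - (∫ z, κ z) * w y‖ ≤ G y * (b / 2 * w y) := by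
          have := hG0 y
          gcongr; exact hLerr y
      _ = _ := by ring
  have hlow : W ≤ 2 / b * ‖∫ y, (G y : ℂ) * L y‖ := by
    have h1 : b * W ≤ ‖∫ y, (G y : ℂ) * L y‖ + b / 2 * W := by
      calc b * W = ‖(∫ z, κ z) * (W : ℂ)‖ := by
            rw [norm_mul, Complex.norm_real, Real.norm_of_nonneg hW0]
        _ = ‖(∫ y, (G y : ℂ) * L y) - ((∫ y, (G y : ℂ) * L y) - (∫ z, κ z) * W)‖ := by
            rw [sub_sub_cancel]
        _ ≤ _ := (norm_sub_le _ _).trans (by gcongr)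
    rw [div_mul_eq_mul_div, le_div_iff₀ hb0]
    linarith
  calc ∫⁻ y, ENNReal.ofReal (w y * G y) = ENNReal.ofReal W :=
        (ofReal_integral_eq_lintegral_ofReal hwG
          (ae_of_all _ fun y => mul_nonneg (Real.exp_nonneg _) (hG0 y))).symm
    _ ≤ ENNReal.ofReal (2 / b * ‖∫ y, (w y : ℂ) * ∫ z, κ z * G (y + z)‖) := by
        rw [hI]; exact ENNReal.ofReal_le_ofReal hlow
    _ = ENNReal.ofReal (2 / b) * ‖∫ y, (w y : ℂ) * ∫ z, κ z * G (y + z)‖ₑ := by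
        rw [ENNReal.ofReal_mul (by positivity), ofReal_norm]
    _ ≤ ENNReal.ofReal (2 / b) * ∫⁻ y, ‖(w y : ℂ) * ∫ z, κ z * G (y + z)‖ₑ := by
        gcongr; exact enorm_integral_le_lintegral_enorm _
    _ = _ := by
        congr 1
        refine lintegral_congr fun y => ?_
        rw [enorm_mul, ← ofReal_norm, Complex.norm_real,
          Real.norm_of_nonneg (Real.exp_nonneg _)]

/-- In the variable `z = log t` the dilations of a line average become translations. -/
theorem integral_Ioi_eq_integral_exp (f : ℝ → ℂ) :
    ∫ t in Set.Ioi 0, f t = ∫ z, (Real.exp z : ℂ) * f (Real.exp z) := by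
  have h := integral_image_eq_integral_abs_deriv_smul (s := Set.univ) (f := Real.exp)
    MeasurableSet.univ (fun x _ => (Real.hasDerivAt_exp x).hasDerivWithinAt)
    Real.exp_injective.injOn f
  rw [Set.image_univ, Real.range_exp] at h
  simpa [abs_of_pos (Real.exp_pos _)] using h

theorem lintegral_Ioi_eq_lintegral_exp (f : ℝ → ℝ≥0∞) :
    ∫⁻ t in Set.Ioi 0, f t = ∫⁻ z, ENNReal.ofReal (Real.exp z) * f (Real.exp z) := by
  have h := lintegral_image_eq_lintegral_abs_deriv_mul (s := Set.univ) (f := Real.exp)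
    MeasurableSet.univ (fun x _ => (Real.hasDerivAt_exp x).hasDerivWithinAt)
    Real.exp_injective.injOn f
  rw [Set.image_univ, Real.range_exp] at h
  simpa [abs_of_pos (Real.exp_pos _)] using h

theorem integral_eq_integral_exp {f : ℝ → ℂ} (hf : Integrable f) :
    ∫ t, f t = ∫ z, (Real.exp z : ℂ) * (f (Real.exp z) + f (-Real.exp z)) := by
  rw [← integral_Ioi_eq_integral_exp fun t => f t + f (-t),
    integral_add hf.integrableOn hf.comp_neg.integrableOn, integral_comp_neg_Ioi, neg_zero,
    add_comm, ← setIntegral_univ, ← Set.Iic_union_Ioi (a := (0 : ℝ)),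
    setIntegral_union (Set.Iic_disjoint_Ioi le_rfl) measurableSet_Ioi hf.integrableOn
      hf.integrableOn]

theorem lintegral_eq_lintegral_exp {f : ℝ → ℝ≥0∞} (hf : Measurable f) :
    ∫⁻ t, f t = ∫⁻ z, ENNReal.ofReal (Real.exp z) * (f (Real.exp z) + f (-Real.exp z)) := by
  have hneg : ∫⁻ t in Set.Ioi 0, f (-t) = ∫⁻ t in Set.Iio 0, f t := by
    have h := (Measure.measurePreserving_neg (volume : Measure ℝ)).setLIntegral_comp_preimage
      (s := Set.Iio 0) measurableSet_Iio hf
    simpa using h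
  rw [← lintegral_Ioi_eq_lintegral_exp fun t => f t + f (-t), lintegral_add_left hf, hneg,
    ← setLIntegral_congr Iio_ae_eq_Iic.symm, add_comm, ← setLIntegral_univ,
    ← Set.Iic_union_Ioi (a := (0 : ℝ)),
    lintegral_union measurableSet_Ioi (Set.Iic_disjoint_Ioi le_rfl)]

/-- The square matters: one factor is a Poisson kernel, the other is spent on the loss caused by a
shear. -/
theorem exists_norm_le_div_sq (ψ : 𝓢(ℝ, ℂ)) :
    ∃ C : ℝ, 0 ≤ C ∧ ∀ t, ‖ψ t‖ ≤ C / (1 + t ^ 2) ^ 2 := by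
  refine ⟨2 * (SchwartzMap.seminorm ℝ 0 0 ψ + SchwartzMap.seminorm ℝ 4 0 ψ), by positivity,
    fun t => ?_⟩
  have h0 := SchwartzMap.norm_le_seminorm ℝ ψ t
  have h4 := SchwartzMap.norm_pow_mul_le_seminorm ℝ ψ 4 t
  have ht : ‖t‖ ^ 4 = t ^ 4 := by rw [Real.norm_eq_abs]; exact (by decide : Even 4).pow_abs t
  rw [ht] at h4
  rw [le_div_iff₀ (by positivity)]
  have h5 : (1 + t ^ 2) ^ 2 ≤ 2 * (1 + t ^ 4) := by nlinarith [sq_nonneg (t ^ 2 - 1)]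
  calc ‖ψ t‖ * (1 + t ^ 2) ^ 2 ≤ ‖ψ t‖ * (2 * (1 + t ^ 4)) := by gcongr
    _ = 2 * (‖ψ t‖ + t ^ 4 * ‖ψ t‖) := by ring
    _ ≤ _ := by gcongr

theorem exp_div_one_add_exp_sq_le (z : ℝ) :
    Real.exp z / (1 + Real.exp z ^ 2) ≤ Real.exp (-|z|) := by
  have hz := Real.exp_pos z
  rcases abs_cases z with ⟨h, -⟩ | ⟨h, -⟩ <;> rw [h]
  · rw [Real.exp_neg, div_le_iff₀ (by positivity), inv_mul_eq_div, le_div_iff₀ hz]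
    nlinarith
  · rw [neg_neg]
    exact div_le_self hz.le (by nlinarith)

theorem fourier_even {φ : 𝓢(ℝ, ℝ)} (h : ∀ t, φ (-t) = φ t) (t : ℝ) :
    𝓕 (toComplex φ) (-t) = 𝓕 (toComplex φ) t := by
  rw [SchwartzMap.fourier_coe, ← Real.fourierInv_eq_fourier_neg,
    Real.fourierInv_eq_fourier_comp_neg]
  exact congrArg (fun F : ℝ → ℂ => 𝓕 F t) (funext fun y => by simp [h])

theorem integral_fourier_toComplex (φ : 𝓢(ℝ, ℝ)) :
    ∫ t, 𝓕 (toComplex φ) t = (φ 0 : ℂ) := by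
  have h : 𝓕⁻ (𝓕 (toComplex φ)) 0 = toComplex φ 0 := by simp
  rw [SchwartzMap.fourierInv_coe, Real.fourierInv_eq'] at h
  simpa using h

/-- The Poisson mean of a nonnegative function along a segment is dominated by a mean over the
dilations of the smooth averages. -/
theorem exists_poisson_mean_le {φ : 𝓢(ℝ, ℝ)} (hφ : ∀ t, φ (-t) = φ t) (h0 : φ 0 ≠ 0) :
    ∃ ε : ℝ, 0 < ε ∧ ∃ c : ℝ≥0, ∀ g : 𝓢(Plane, ℂ), (∀ x, g x = (‖g x‖ : ℂ)) →
      ∀ (u : Plane) (s : ℝ) (x : Plane),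
        ∫⁻ t, poisson 1 t * ‖g (x + t • (2 * Real.pi * s) • u)‖ₑ
          ≤ c * ∫⁻ y, ENNReal.ofReal (Real.exp (-(ε * |y|)))
              * ‖avg φ u (Real.exp y * s) g x‖ₑ := by
  set K := 𝓕 (toComplex φ) with hK
  obtain ⟨C, hC0, hC⟩ := exists_norm_le_div_sq K
  set κ : ℝ → ℂ := fun z => (Real.exp z : ℂ) * K (Real.exp z) with hκ
  have hκc : Continuous κ := by
    have := K.continuous
    fun_prop
  have hκC : ∀ z, ‖κ z‖ ≤ C * Real.exp (-|z|) := by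
    intro z
    rw [hκ, norm_mul, Complex.norm_real, Real.norm_of_nonneg (Real.exp_nonneg z)]
    calc Real.exp z * ‖K (Real.exp z)‖
        ≤ Real.exp z * (C / (1 + Real.exp z ^ 2)) := by
          gcongr
          refine (hC _).trans ?_
          gcongr
          exact le_self_pow₀ (by nlinarith [sq_nonneg (Real.exp z)]) two_ne_zero
      _ = C * (Real.exp z / (1 + Real.exp z ^ 2)) := by ring
      _ ≤ _ := by gcongr; exact exp_div_one_add_exp_sq_le z
  -- As `K` is even, this integral is half of `∫ K = φ 0`.
  have hint : ∫ z, κ z ≠ 0 := by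
    have h := integral_eq_integral_exp K.integrable
    rw [integral_fourier_toComplex] at h
    have h2 : ∀ z, (Real.exp z : ℂ) * (K (Real.exp z) + K (-Real.exp z)) = 2 * κ z := by
      intro z
      rw [hK, fourier_even hφ, hκ]; ring
    simp only [h2, integral_const_mul] at h
    intro h3
    rw [h3, mul_zero] at h
    exact h0 (by exact_mod_cast h)
  obtain ⟨ε, hε0, hε1, c, hc⟩ := exists_exp_weight_le hκc hκC hint
  refine ⟨ε, hε0, c, fun g hg u s x => ?_⟩
  set w := (2 * Real.pi * s) • u with hw
  set G : ℝ → ℝ := fun z => ‖g (x + Real.exp z • w)‖ + ‖g (x + (-Real.exp z) • w)‖ with hG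
  have hGc : Continuous G := by
    have := g.continuous
    fun_prop
  have hG0 : ∀ z, 0 ≤ G z := fun z => by positivity
  have hGM : ∀ z, G z ≤ SchwartzMap.seminorm ℝ 0 0 g + SchwartzMap.seminorm ℝ 0 0 g := fun z =>
    add_le_add (SchwartzMap.norm_le_seminorm ℝ g _) (SchwartzMap.norm_le_seminorm ℝ g _)
  -- Only here is `g` required to equal its modulus: folding the two half lines turns the average
  -- into a correlation with the nonnegative `G`.
  have havg : ∀ y, avg φ u (Real.exp y * s) g x = ∫ z, κ z * G (y + z) := by
    intro y
    have hi : Integrable fun t => K t * g (x + t • (2 * Real.pi * (Real.exp y * s)) • u) := by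
      refine K.integrable.mul_bdd (c := SchwartzMap.seminorm ℝ 0 0 g)
        (g.continuous.comp (by fun_prop)).aestronglyMeasurable
        (ae_of_all _ fun t => SchwartzMap.norm_le_seminorm ℝ g _)
    rw [avg_eq_integral, integral_eq_integral_exp hi]
    refine integral_congr_ae (ae_of_all _ fun z => ?_)
    have e1 : ∀ t : ℝ, (t • (2 * Real.pi * (Real.exp y * s)) • u) = (Real.exp y * t) • w := by
      intro t
      rw [hw, smul_smul, smul_smul]; congr 1; ring
    simp only [e1]
    rw [hK, fourier_even hφ, hκ, hG]
    simp only [Complex.ofReal_add, ← hg]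
    rw [mul_neg, Real.exp_add]
    ring
  have hgm : Measurable fun t : ℝ => poisson 1 t * ‖g (x + t • w)‖ₑ := by
    have : Measurable fun t : ℝ => g (x + t • w) := (g.continuous.comp (by fun_prop)).measurable
    exact (measurable_poisson 1).mul this.enorm
  calc ∫⁻ t, poisson 1 t * ‖g (x + t • w)‖ₑ
      ≤ ∫⁻ z, ENNReal.ofReal (Real.exp (-(ε * |z|)) * G z) := by
        rw [lintegral_eq_lintegral_exp hgm]
        refine lintegral_mono fun z => ?_
        simp only
        rw [poisson_neg, ← mul_add, ← ofReal_norm, ← ofReal_norm,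
          ← ENNReal.ofReal_add (norm_nonneg _) (norm_nonneg _), ← mul_assoc, poisson,
          ← ENNReal.ofReal_mul (Real.exp_nonneg _), ← ENNReal.ofReal_mul (by positivity)]
        refine ENNReal.ofReal_le_ofReal ?_
        refine mul_le_mul_of_nonneg_right ?_ (hG0 z)
        rw [one_pow, mul_one_div]
        refine (exp_div_one_add_exp_sq_le z).trans (Real.exp_le_exp.2 ?_)
        have := abs_nonneg z
        nlinarith
    _ ≤ _ := by
        simp only [havg]
        exact hc G _ hGc hG0 hGM

/-! ### A majorant of the Poisson means in the directions of `U`. -/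

section

open scoped ContDiff

/-- The modulus of a Schwartz function is a limit from below of nonnegative Schwartz functions. -/
theorem exists_nonneg_tendsto_norm (f : 𝓢(Plane, ℂ)) :
    ∃ g : ℕ → 𝓢(Plane, ℂ), (∀ n x, g n x = (‖g n x‖ : ℂ)) ∧ (∀ n x, ‖g n x‖ ≤ ‖f x‖) ∧
      ∀ x, Tendsto (fun n => ‖g n x‖) atTop (𝓝 ‖f x‖) := by
  let b : ∀ n : ℕ, ContDiffBump (0 : Plane) := fun n => ⟨n + 1, n + 2, by positivity, by linarith⟩
  let δ : ℕ → ℝ := fun n => 1 / ((n : ℝ) + 1)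
  have hδ : ∀ n, 0 < δ n := fun n => by positivity
  -- The regularized square root is smooth even at zeros of `f`; subtracting `δ n` keeps it below
  -- the modulus, and the bump gives compact support.
  let r : ℕ → Plane → ℝ := fun n x => b n x * (√(‖f x‖ ^ 2 + δ n ^ 2) - δ n)
  have hsub0 : ∀ n x, 0 ≤ √(‖f x‖ ^ 2 + δ n ^ 2) - δ n := fun n x =>
    sub_nonneg.2 (Real.le_sqrt_of_sq_le (by nlinarith [sq_nonneg ‖f x‖]))
  have hsub1 : ∀ n x, √(‖f x‖ ^ 2 + δ n ^ 2) - δ n ≤ ‖f x‖ := by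
    intro n x
    rw [sub_le_iff_le_add]
    refine Real.sqrt_le_iff.2 ⟨by have := hδ n; positivity, ?_⟩
    nlinarith [mul_nonneg (norm_nonneg (f x)) (hδ n).le]
  have hr0 : ∀ n x, 0 ≤ r n x := fun n x => mul_nonneg (b n).nonneg (hsub0 n x)
  have hr1 : ∀ n x, r n x ≤ ‖f x‖ := fun n x =>
    (mul_le_of_le_one_left (hsub0 n x) (b n).le_one).trans (hsub1 n x)
  have hrs : ∀ n, ContDiff ℝ ∞ fun x => (r n x : ℂ) := by
    intro n
    refine Complex.ofRealCLM.contDiff.comp ((b n).contDiff.mul (ContDiff.sub ?_ contDiff_const))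
    refine ContDiff.sqrt (((f.smooth ⊤).norm_sq ℝ).add contDiff_const) fun x => ?_
    have := hδ n
    positivity
  have hrc : ∀ n, HasCompactSupport fun x => (r n x : ℂ) := fun n =>
    ((b n).hasCompactSupport.mul_right).comp_left (g := fun t : ℝ => (t : ℂ)) (by simp)
  have happ : ∀ n x, ‖(hrc n).toSchwartzMap (hrs n) x‖ = r n x := by
    intro n x
    change ‖(r n x : ℂ)‖ = _
    rw [Complex.norm_real, Real.norm_of_nonneg (hr0 n x)]
  refine ⟨fun n => (hrc n).toSchwartzMap (hrs n), fun n x => ?_, fun n x => ?_, fun x => ?_⟩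
  · rw [happ]; rfl
  · rw [happ]; exact hr1 n x
  · simp only [happ]
    have hδ0 : Tendsto δ atTop (𝓝 0) := tendsto_one_div_add_atTop_nhds_zero_nat
    have h1 : Tendsto (fun n => √(‖f x‖ ^ 2 + δ n ^ 2) - δ n) atTop (𝓝 ‖f x‖) := by
      have h2 : Continuous fun d : ℝ => √(‖f x‖ ^ 2 + d ^ 2) - d := by fun_prop
      have h3 := (h2.tendsto 0).comp hδ0
      simpa [Function.comp_def] using h3
    refine h1.congr' ?_
    obtain ⟨n, hn⟩ := exists_nat_ge ‖x‖
    filter_upwards [eventually_ge_atTop n] with m hm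
    have : b m x = 1 := by
      refine (b m).one_of_mem_closedBall ?_
      rw [mem_closedBall_zero_iff]
      have : (n : ℝ) ≤ m := by exact_mod_cast hm
      change ‖x‖ ≤ (m : ℝ) + 1
      linarith
    simp [r, this]

theorem lintegral_exp_weight {ε : ℝ} (hε : 0 < ε) :
    ∫⁻ y, ENNReal.ofReal (Real.exp (-(ε * |y|))) = ENNReal.ofReal (2 / ε) := by
  rw [← ofReal_integral_eq_lintegral_ofReal (integrable_exp_neg_mul_abs hε)
    (ae_of_all _ fun y => Real.exp_nonneg _), integral_exp_neg_mul_abs hε]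

/-- The mean of the maximal averages over all dilations, with an exponential weight. -/
def dilMean (φ : 𝓢(ℝ, ℝ)) (V : Set Plane) (S : Set ℝ) (ε : ℝ) (f : 𝓢(Plane, ℂ)) (x : Plane) :
    ℝ≥0∞ :=
  ∫⁻ y, ENNReal.ofReal (Real.exp (-(ε * |y|))) * dilMaxAvg φ V S f y x

theorem measurable_dilMaxAvg_swap (φ : 𝓢(ℝ, ℝ)) (V : Set Plane) (S : Set ℝ) (f : 𝓢(Plane, ℂ)) :
    Measurable fun p : Plane × ℝ => dilMaxAvg φ V S f p.2 p.1 := by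
  have h := measurable_dilMaxAvg φ V S f
  fun_prop

theorem measurable_dilMean (φ : 𝓢(ℝ, ℝ)) (V : Set Plane) (S : Set ℝ) (ε : ℝ) (f : 𝓢(Plane, ℂ)) :
    Measurable (dilMean φ V S ε f) := by
  have h := measurable_dilMaxAvg_swap φ V S f
  refine Measurable.lintegral_prod_right' (f := fun p : Plane × ℝ =>
    ENNReal.ofReal (Real.exp (-(ε * |p.2|))) * dilMaxAvg φ V S f p.2 p.1) ?_
  exact Measurable.mul (by fun_prop) h

/-- Cauchy-Schwarz against a weight of total mass `2 / ε`, after which every dilation obeys the same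
`L²` bound. -/
theorem lintegral_dilMean_sq_le {φ : 𝓢(ℝ, ℝ)} {V : Set Plane} {S : Set ℝ} {A : ℝ≥0∞}
    (hA : ∀ f : 𝓢(Plane, ℂ), ∫⁻ x, maxAvg φ V S f x ^ 2 ≤ A * ∫⁻ x, ‖f x‖ₑ ^ 2)
    {ε : ℝ} (hε : 0 < ε) (f : 𝓢(Plane, ℂ)) :
    ∫⁻ x, dilMean φ V S ε f x ^ 2 ≤ ENNReal.ofReal (2 / ε) ^ 2 * A * ∫⁻ x, ‖f x‖ₑ ^ 2 := by
  set w : ℝ → ℝ≥0∞ := fun y => ENNReal.ofReal (Real.exp (-(ε * |y|))) with hw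
  have hwm : Measurable w := by fun_prop
  have hwm2 : Measurable fun p : Plane × ℝ => w p.2 := by fun_prop
  have hsq : Measurable fun p : Plane × ℝ => dilMaxAvg φ V S f p.2 p.1 ^ 2 :=
    (measurable_dilMaxAvg_swap φ V S f).pow_const 2
  have hx : ∀ x, Measurable fun y => dilMaxAvg φ V S f y x := fun x => by
    have h := measurable_dilMaxAvg φ V S f
    fun_prop
  calc ∫⁻ x, dilMean φ V S ε f x ^ 2
      ≤ ∫⁻ x, ENNReal.ofReal (2 / ε) * ∫⁻ y, w y * dilMaxAvg φ V S f y x ^ 2 := by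
        refine lintegral_mono fun x => ?_
        rw [← lintegral_exp_weight hε]
        exact sq_lintegral_weight_mul_le hwm (hx x)
    _ = ENNReal.ofReal (2 / ε) * ∫⁻ x, ∫⁻ y, w y * dilMaxAvg φ V S f y x ^ 2 :=
        lintegral_const_mul' _ _ (by simp)
    _ = ENNReal.ofReal (2 / ε) * ∫⁻ y, ∫⁻ x, w y * dilMaxAvg φ V S f y x ^ 2 := by
        rw [lintegral_lintegral_swap]
        exact (hwm2.mul hsq).aemeasurable
    _ ≤ ENNReal.ofReal (2 / ε) * ∫⁻ y, w y * (A * ∫⁻ x, ‖f x‖ₑ ^ 2) := by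
        gcongr with y
        rw [lintegral_const_mul' _ _ (by simp [hw])]
        gcongr
        exact lintegral_dilMaxAvg_sq_le hA f y
    _ = _ := by
        rw [lintegral_mul_const _ hwm, lintegral_exp_weight hε]
        ring

/-- The Poisson means of `|f|` at the scales in `S` along the directions in `U` have a common
majorant whose `L²` norm is controlled by that of the maximal average. -/
theorem exists_poisson_majorant {φ : 𝓢(ℝ, ℝ)} (hφ : ∀ t, φ (-t) = φ t) (h0 : φ 0 ≠ 0) :
    ∃ c : ℝ≥0, ∀ (U : Set Plane) (S : Set ℝ) (A : ℝ≥0∞),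
      (∀ f : 𝓢(Plane, ℂ), ∫⁻ x, maxAvg φ U S f x ^ 2 ≤ A * ∫⁻ x, ‖f x‖ₑ ^ 2) →
      ∀ f : 𝓢(Plane, ℂ), ∃ Q : Plane → ℝ≥0∞, Measurable Q ∧
        ∫⁻ x, Q x ^ 2 ≤ c * A * ∫⁻ x, ‖f x‖ₑ ^ 2 ∧
        ∀ u ∈ U, ∀ s ∈ S, ∀ x,
          ∫⁻ t, poisson 1 t * ‖f (x + t • (2 * Real.pi * s) • u)‖ₑ ≤ Q x := by
  obtain ⟨ε, hε, c, hc⟩ := exists_poisson_mean_le hφ h0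
  refine ⟨c ^ 2 * (2 / ε).toNNReal ^ 2, fun U S A hA f => ?_⟩
  let T : 𝓢(Plane, ℂ) → Plane → ℝ≥0∞ := fun g x => c * dilMean φ U S ε g x
  have hT : ∀ g, Measurable (T g) := fun g => (measurable_dilMean φ U S ε g).const_mul _
  have hTsq : ∀ g, ∫⁻ x, T g x ^ 2
      ≤ c ^ 2 * ENNReal.ofReal (2 / ε) ^ 2 * A * ∫⁻ x, ‖g x‖ₑ ^ 2 := by
    intro g
    simp only [T, mul_pow]
    rw [lintegral_const_mul' _ _ (by simp)]
    calc _ ≤ (c : ℝ≥0∞) ^ 2 * (ENNReal.ofReal (2 / ε) ^ 2 * A * ∫⁻ x, ‖g x‖ₑ ^ 2) := by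
          gcongr; exact lintegral_dilMean_sq_le hA hε g
      _ = _ := by ring
  obtain ⟨g, hg0, hg1, hg2⟩ := exists_nonneg_tendsto_norm f
  have hT' : ∀ n, ∀ u ∈ U, ∀ s ∈ S, ∀ x,
      ∫⁻ t, poisson 1 t * ‖g n (x + t • (2 * Real.pi * s) • u)‖ₑ ≤ T (g n) x := by
    intro n u hu s hs x
    refine (hc (g n) (hg0 n) u s x).trans ?_
    simp only [T, dilMean]
    gcongr with y
    exact le_iSup₂_of_le u hu (le_iSup₂_of_le s hs le_rfl)
  -- Fatou's lemma is used twice: in `x` for the norm of the majorant, and in `t` for the pointwise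
  -- domination.
  refine ⟨fun x => liminf (fun n => T (g n) x) atTop, Measurable.liminf fun n => hT (g n), ?_, ?_⟩
  · have hpow : ∀ x, (liminf (fun n => T (g n) x) atTop) ^ 2
        = liminf (fun n => T (g n) x ^ 2) atTop := by
      intro x
      exact Monotone.map_liminf_of_continuousAt (f := fun a : ℝ≥0∞ => a ^ 2)
        (fun a b hab => pow_le_pow_left' hab 2) _ (ENNReal.continuous_pow 2).continuousAt
    simp only [hpow]
    refine (lintegral_liminf_le fun n => (hT (g n)).pow_const 2).trans ?_
    refine liminf_le_of_le (by isBoundedDefault) fun b hb => ?_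
    obtain ⟨n, hn⟩ := hb.exists
    refine hn.trans ((hTsq (g n)).trans ?_)
    push_cast
    rw [ENNReal.ofReal]
    gcongr with x
    rw [enorm_le_iff_norm_le]
    exact hg1 n x
  · intro u hu s hs x
    have hlim : ∀ t, poisson 1 t * ‖f (x + t • (2 * Real.pi * s) • u)‖ₑ
        = liminf (fun n => poisson 1 t * ‖g n (x + t • (2 * Real.pi * s) • u)‖ₑ) atTop := by
      intro t
      refine (Tendsto.liminf_eq ?_).symm
      refine ENNReal.Tendsto.const_mul ?_ (Or.inr (by simp [poisson]))
      simp only [← ofReal_norm]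
      exact ENNReal.tendsto_ofReal (hg2 _)
    simp only [hlim]
    refine (lintegral_liminf_le fun n => ?_).trans ?_
    · have : Measurable fun t : ℝ => g n (x + t • (2 * Real.pi * s) • u) :=
        ((g n).continuous.comp (by fun_prop)).measurable
      exact (measurable_poisson 1).mul this.enorm
    · exact liminf_le_liminf (Eventually.of_forall fun n => hT' n u hu s hs x)

end

/-! ### A majorant of the mixed averages. -/

theorem lineMean_smul_one (e : Plane) {c : ℝ} (hc : c ≠ 0) {F : Plane → ℝ≥0∞} (hF : Measurable F)
    (x : Plane) : lineMean (c • e) 1 F x = lineMean e |c| F x := by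
  have hm : Measurable fun t : ℝ => poisson 1 (c⁻¹ * t) * F (x + t • e) := by
    have h : Measurable fun t : ℝ => poisson 1 (c⁻¹ * t) := by fun_prop
    fun_prop
  calc lineMean (c • e) 1 F x = ∫⁻ t, poisson 1 (c⁻¹ * (c * t)) * F (x + (c * t) • e) := by
        refine lintegral_congr fun t => ?_
        rw [inv_mul_cancel_left₀ hc, smul_smul, mul_comm t c]
    _ = ENNReal.ofReal |c⁻¹| * ∫⁻ t, poisson 1 (c⁻¹ * t) * F (x + t • e) := by
        rw [← lintegral_map (μ := volume) hm (measurable_const_mul c), Real.map_volume_mul_left hc,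
          lintegral_smul_measure, smul_eq_mul]
    _ = _ := by
        rw [← lintegral_const_mul _ hm]
        refine lintegral_congr fun t => ?_
        rw [← mul_assoc, poisson, poisson, ← ENNReal.ofReal_mul (abs_nonneg _)]
        congr 2
        have : 0 < |c| := abs_pos.2 hc
        rw [abs_inv, sq_abs, mul_pow, inv_pow]
        have hc2 : c ^ 2 = |c| ^ 2 := (sq_abs c).symm
        rw [hc2]
        field_simp

/-- The first term of the maximum is for `c = 0`, where the line degenerates to a point and no
positive radius is available. This happens when `v` is parallel to `u`. -/
theorem lineMean_smul_one_le (e : Plane) (c : ℝ) {F : Plane → ℝ≥0∞} (hF : Measurable F)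
    (x : Plane) :
    lineMean (c • e) 1 F x ≤ max (ENNReal.ofReal Real.pi * F x) (2 * dyadicMean e F x) := by
  rcases eq_or_ne c 0 with rfl | hc
  · refine le_max_of_le_left (le_of_eq ?_)
    simp only [lineMean, zero_smul, smul_zero, add_zero]
    rw [lintegral_mul_const _ (measurable_poisson 1), lintegral_poisson one_pos]
  · rw [lineMean_smul_one e hc hF]
    exact le_max_of_le_right (lineMean_le_dyadicMean e (abs_pos.2 hc) F x)

/-- Every vector of norm one is the sum of a multiple, with a bounded factor, of a given one and
of a vector on one of the coordinate axes. -/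
theorem exists_axis_decomposition {u v : Plane} (hu : ‖u‖ = 1) (hv : ‖v‖ = 1) :
    ∃ (i : Fin 2) (a b : ℝ), a ^ 2 ≤ 2 ∧ v = a • u + b • EuclideanSpace.single i 1 := by
  have hu2 : u 0 ^ 2 + u 1 ^ 2 = 1 := by
    have := EuclideanSpace.real_norm_sq_eq u
    rw [hu, Fin.sum_univ_two] at this; linarith
  have hv2 : v 0 ^ 2 + v 1 ^ 2 = 1 := by
    have := EuclideanSpace.real_norm_sq_eq v
    rw [hv, Fin.sum_univ_two] at this; linarith
  -- Dividing by the larger coordinate of `u`, whose square is at least `1/2`, gives `a ^ 2 ≤ 2`.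
  rcases le_total (u 1 ^ 2) (u 0 ^ 2) with h | h
  · have h0 : u 0 ≠ 0 := by rintro h0; rw [h0] at h hu2; nlinarith
    refine ⟨1, v 0 / u 0, v 1 - v 0 / u 0 * u 1, ?_, ?_⟩
    · rw [div_pow, div_le_iff₀ (by positivity)]; nlinarith [sq_nonneg (v 1)]
    · ext i; fin_cases i
      · simp [h0]
      · simp
  · have h0 : u 1 ≠ 0 := by rintro h0; rw [h0] at h hu2; nlinarith
    refine ⟨0, v 1 / u 1, v 0 - v 1 / u 1 * u 0, ?_, ?_⟩
    · rw [div_pow, div_le_iff₀ (by positivity)]; nlinarith [sq_nonneg (v 0)]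
    · ext i; fin_cases i
      · simp
      · simp [h0]

theorem enorm_mixedAvg_le (φ χ : 𝓢(ℝ, ℝ)) (u v : Plane) (s : ℝ) (f : 𝓢(Plane, ℂ)) (x : Plane) :
    ‖mixedAvg φ χ u v s f x‖ₑ ≤ ∫⁻ t, ‖𝓕 (toComplex φ) t‖ₑ * ∫⁻ q, ‖𝓕 (toComplex χ) q‖ₑ
      * ‖f (x + t • (2 * Real.pi * s) • v + q • (2 * Real.pi * s) • u)‖ₑ := by
  rw [mixedAvg_eq_integral]
  refine (enorm_integral_le_lintegral_enorm _).trans (lintegral_mono fun t => ?_)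
  rw [enorm_mul]
  gcongr
  refine (enorm_integral_le_lintegral_enorm _).trans (lintegral_mono fun q => ?_)
  rw [enorm_mul]

/-- The two parameter averages are dominated by Poisson means along a coordinate axis of a common
majorant of the Poisson means along `u`. -/
theorem exists_mixedAvg_le (φ χ : 𝓢(ℝ, ℝ)) :
    ∃ c : ℝ≥0, ∀ (u v : Plane) (s : ℝ) (f : 𝓢(Plane, ℂ)) (Q : Plane → ℝ≥0∞), ‖u‖ = 1 → ‖v‖ = 1 →
      (∀ x, ∫⁻ t, poisson 1 t * ‖f (x + t • (2 * Real.pi * s) • u)‖ₑ ≤ Q x) →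
      ∀ x, ∃ (i : Fin 2) (b : ℝ),
        ‖mixedAvg φ χ u v s f x‖ₑ
          ≤ c * lineMean (b • EuclideanSpace.single i 1) 1 Q x := by
  obtain ⟨C, hC0, hC⟩ := exists_norm_le_div_sq (𝓕 (toComplex φ))
  obtain ⟨D, hD0, hD⟩ := exists_norm_le_div_sq (𝓕 (toComplex χ))
  refine ⟨(C * (4 * D)).toNNReal, fun u v s f Q hu hv hQ x => ?_⟩
  obtain ⟨i, a, b, ha, hab⟩ := exists_axis_decomposition hu hv
  set w := 2 * Real.pi * s with hw
  refine ⟨i, w * b, (enorm_mixedAvg_le φ χ u v s f x).trans ?_⟩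
  have hinner : ∀ t, ∫⁻ q, ‖𝓕 (toComplex χ) q‖ₑ * ‖f (x + t • w • v + q • w • u)‖ₑ
      ≤ ENNReal.ofReal (4 * D * (1 + t ^ 2))
        * Q (x + t • (w * b) • EuclideanSpace.single i 1) := by
    intro t
    -- The shift of `q` by `t * a` removes the `u`-component of `v` from the displacement. Its price
    -- in the kernel of `χ` is the factor `4 (1 + t²)`.
    calc ∫⁻ q, ‖𝓕 (toComplex χ) q‖ₑ * ‖f (x + t • w • v + q • w • u)‖ₑ
        = ∫⁻ q, ‖𝓕 (toComplex χ) (q - t * a)‖ₑ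
            * ‖f (x + t • w • v + (q - t * a) • w • u)‖ₑ :=
          (lintegral_sub_right_eq_self (fun q => ‖𝓕 (toComplex χ) q‖ₑ
            * ‖f (x + t • w • v + q • w • u)‖ₑ) (t * a)).symm
      _ ≤ ∫⁻ q, ENNReal.ofReal (4 * D * (1 + t ^ 2)) * (poisson 1 q
            * ‖f (x + t • (w * b) • EuclideanSpace.single i 1 + q • w • u)‖ₑ) := by
          refine lintegral_mono fun q => ?_
          have e1 : x + t • w • v + (q - t * a) • w • u
              = x + t • (w * b) • EuclideanSpace.single i 1 + q • w • u := by
            rw [hab]; module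
          simp only [e1]
          rw [← mul_assoc]
          gcongr
          rw [← ofReal_norm, poisson, ← ENNReal.ofReal_mul (by positivity)]
          refine ENNReal.ofReal_le_ofReal ((hD _).trans ?_)
          rw [one_pow, mul_one_div, div_le_div_iff₀ (by positivity) (by positivity)]
          have h1 : 1 + q ^ 2 ≤ 4 * (1 + t ^ 2) * (1 + (q - t * a) ^ 2) := by
            have h2 : q ^ 2 ≤ 2 * (q - t * a) ^ 2 + 2 * (t ^ 2 * a ^ 2) := by
              nlinarith [sq_nonneg (q - 2 * (t * a))]
            have h3 : t ^ 2 * a ^ 2 ≤ t ^ 2 * 2 := by gcongr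
            nlinarith [mul_nonneg (sq_nonneg t) (sq_nonneg (q - t * a)), sq_nonneg t,
              sq_nonneg (q - t * a)]
          have h4 : 1 + (q - t * a) ^ 2 ≤ (1 + (q - t * a) ^ 2) ^ 2 :=
            le_self_pow₀ (by nlinarith [sq_nonneg (q - t * a)]) two_ne_zero
          calc D * (1 + q ^ 2) ≤ D * (4 * (1 + t ^ 2) * (1 + (q - t * a) ^ 2)) := by gcongr
            _ ≤ D * (4 * (1 + t ^ 2) * (1 + (q - t * a) ^ 2) ^ 2) := by gcongr
            _ = _ := by ring
      _ = ENNReal.ofReal (4 * D * (1 + t ^ 2)) * ∫⁻ q, poisson 1 q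
            * ‖f (x + t • (w * b) • EuclideanSpace.single i 1 + q • w • u)‖ₑ :=
          lintegral_const_mul' _ _ (by simp)
      _ ≤ _ := by gcongr; exact hQ _
  calc _ ≤ ∫⁻ t, ‖𝓕 (toComplex φ) t‖ₑ * (ENNReal.ofReal (4 * D * (1 + t ^ 2))
          * Q (x + t • (w * b) • EuclideanSpace.single i 1)) := by
        gcongr with t; exact hinner t
    _ ≤ ∫⁻ t, ENNReal.ofReal (C * (4 * D)) * (poisson 1 t
          * Q (x + t • (w * b) • EuclideanSpace.single i 1)) := by
        refine lintegral_mono fun t => ?_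
        rw [← mul_assoc, ← mul_assoc]
        refine mul_le_mul_left ?_ _
        rw [← ofReal_norm, poisson, ← ENNReal.ofReal_mul (norm_nonneg _),
          ← ENNReal.ofReal_mul (by positivity)]
        refine ENNReal.ofReal_le_ofReal ?_
        -- One of the two factors of decay absorbs the price of the shear; the other remains as a
        -- Poisson kernel in `t`.
        calc ‖𝓕 (toComplex φ) t‖ * (4 * D * (1 + t ^ 2))
            ≤ C / (1 + t ^ 2) ^ 2 * (4 * D * (1 + t ^ 2)) := by gcongr; exact hC t
          _ = _ := by field_simp
    _ = _ := lintegral_const_mul' _ _ (by simp)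

/-- The two parameter averages with the first direction in `U` have a common majorant whose `L²`
norm is controlled by that of the maximal average over `U`, whatever the second direction. -/
theorem exists_mixedAvg_majorant {φ : 𝓢(ℝ, ℝ)} (hφ : ∀ t, φ (-t) = φ t) (h0 : φ 0 ≠ 0)
    (χ : 𝓢(ℝ, ℝ)) :
    ∃ c : ℝ≥0, ∀ (U : Set Plane) (S : Set ℝ) (A : ℝ≥0∞), (∀ u ∈ U, ‖u‖ = 1) →
      (∀ f : 𝓢(Plane, ℂ), ∫⁻ x, maxAvg φ U S f x ^ 2 ≤ A * ∫⁻ x, ‖f x‖ₑ ^ 2) →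
      ∀ f : 𝓢(Plane, ℂ), ∃ Q : Plane → ℝ≥0∞, Measurable Q ∧
        ∫⁻ x, Q x ^ 2 ≤ c * A * ∫⁻ x, ‖f x‖ₑ ^ 2 ∧
        ∀ u ∈ U, ∀ v, ‖v‖ = 1 → ∀ s ∈ S, ∀ x, ‖mixedAvg φ χ u v s f x‖ₑ ≤ Q x := by
  obtain ⟨c, hc⟩ := exists_poisson_majorant hφ h0
  obtain ⟨d, hd⟩ := exists_mixedAvg_le φ χ
  -- `π²` comes from the degenerate term, and `2² * 65 π²` from each of the two axes.
  let k : ℝ≥0 := (Real.pi ^ 2 + 8 * (65 * Real.pi ^ 2)).toNNReal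
  refine ⟨d ^ 2 * k * c, fun U S A hU hA f => ?_⟩
  obtain ⟨Q, hQm, hQ2, hQ⟩ := hc U S A hA f
  let e : Fin 2 → Plane := fun i => EuclideanSpace.single i 1
  let N : Plane → ℝ≥0∞ := fun x =>
    max (ENNReal.ofReal Real.pi * Q x) (max (2 * dyadicMean (e 0) Q x) (2 * dyadicMean (e 1) Q x))
  have hN : Measurable N := by fun_prop
  have hNsq : ∫⁻ x, N x ^ 2 ≤ k * ∫⁻ x, Q x ^ 2 := by
    calc ∫⁻ x, N x ^ 2
        ≤ ∫⁻ x, (ENNReal.ofReal Real.pi ^ 2 * Q x ^ 2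
            + (2 ^ 2 * dyadicMean (e 0) Q x ^ 2 + 2 ^ 2 * dyadicMean (e 1) Q x ^ 2)) := by
          refine lintegral_mono fun x => ?_
          simp only [N, ← mul_pow]
          generalize ENNReal.ofReal Real.pi * Q x = p
          generalize 2 * dyadicMean (e 0) Q x = q
          generalize 2 * dyadicMean (e 1) Q x = r
          rcases max_choice p (max q r) with h | h <;> rw [h]
          · exact le_self_add
          · rcases max_choice q r with h' | h' <;> rw [h']
            · exact le_add_self.trans (add_le_add_right le_self_add _)
            · exact le_add_self.trans (add_le_add_right le_add_self _)
      _ = ENNReal.ofReal Real.pi ^ 2 * (∫⁻ x, Q x ^ 2)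
            + (2 ^ 2 * (∫⁻ x, dyadicMean (e 0) Q x ^ 2)
              + 2 ^ 2 * ∫⁻ x, dyadicMean (e 1) Q x ^ 2) := by
          rw [lintegral_add_left (by fun_prop), lintegral_add_left (by fun_prop),
            lintegral_const_mul _ (by fun_prop), lintegral_const_mul _ (by fun_prop),
            lintegral_const_mul _ (by fun_prop)]
      _ ≤ ENNReal.ofReal Real.pi ^ 2 * (∫⁻ x, Q x ^ 2)
            + (2 ^ 2 * (ENNReal.ofReal (65 * Real.pi ^ 2) * ∫⁻ x, Q x ^ 2)
              + 2 ^ 2 * (ENNReal.ofReal (65 * Real.pi ^ 2) * ∫⁻ x, Q x ^ 2)) := by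
          gcongr
          · exact lintegral_dyadicMean_sq_le (e 0) hQm
          · exact lintegral_dyadicMean_sq_le (e 1) hQm
      _ = _ := by
          have hk : (k : ℝ≥0∞)
              = ENNReal.ofReal Real.pi ^ 2 + 8 * ENNReal.ofReal (65 * Real.pi ^ 2) := by
            change ENNReal.ofReal _ = _
            rw [ENNReal.ofReal_add (by positivity) (by positivity),
              ENNReal.ofReal_pow (by positivity), ENNReal.ofReal_mul (p := 8) (by norm_num)]
            simp
          rw [hk]; ring
  refine ⟨fun x => d * N x, hN.const_mul _, ?_, fun u hu v hv s hs x => ?_⟩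
  · calc ∫⁻ x, (d * N x) ^ 2 = (d : ℝ≥0∞) ^ 2 * ∫⁻ x, N x ^ 2 := by
          simp only [mul_pow]
          exact lintegral_const_mul' _ _ (by simp)
      _ ≤ (d : ℝ≥0∞) ^ 2 * (k * (c * A * ∫⁻ x, ‖f x‖ₑ ^ 2)) := by
          gcongr; exact hNsq.trans (by gcongr)
      _ = _ := by push_cast; ring
  · obtain ⟨i, b, hb⟩ := hd u v s f Q (hU u hu) hv (hQ u hu s hs) x
    refine hb.trans (mul_le_mul_right ?_ _)
    refine (lineMean_smul_one_le _ b hQm x).trans (max_le_max le_rfl ?_)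
    fin_cases i
    · exact le_max_left _ _
    · exact le_max_right _ _

/-! ### Geometry of the sectors and frequency localization. -/

section

open scoped ContDiff

theorem inner_dir (a : ℝ) (ξ : Plane) :
    inner ℝ (dir a) ξ = Real.cos a * ξ 0 + Real.sin a * ξ 1 := by
  simp [dir, PiLp.inner_apply, Fin.sum_univ_two, mul_comm]

theorem norm_dir (a : ℝ) : ‖dir a‖ = 1 := by
  have h := EuclideanSpace.real_norm_sq_eq (dir a)
  rw [Fin.sum_univ_two] at h
  simp only [dir] at h ⊢
  simp only [Matrix.cons_val_zero, Matrix.cons_val_one] at h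
  have h2 : ‖(!₂[Real.cos a, Real.sin a] : Plane)‖ ^ 2 = 1 := by
    rw [h]; simp
  exact (pow_eq_one_iff_of_nonneg (norm_nonneg _) two_ne_zero).1 h2

/-- The linear dependence of three vectors in the plane. Within a half circle, with `a ≤ b ≤ c`, all
the sines are nonnegative, which makes signs transfer. -/
theorem inner_dir_mul_sin (a b c : ℝ) (ξ : Plane) :
    inner ℝ (dir b) ξ * Real.sin (c - a)
      = inner ℝ (dir a) ξ * Real.sin (c - b) + inner ℝ (dir c) ξ * Real.sin (b - a) := by
  simp only [inner_dir, Real.sin_sub]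
  ring

/-- The linear form of a frequency changes its sign at most once on a half circle. -/
theorem inner_dir_sign_change {a b c d : ℝ} (hab : a < b) (hbc : b ≤ c) (hcd : c < d)
    (hda : d ≤ a + Real.pi) {ξ : Plane} (h : inner ℝ (dir a) ξ * inner ℝ (dir b) ξ < 0) :
    0 ≤ inner ℝ (dir c) ξ * inner ℝ (dir d) ξ := by
  have hs : 0 < Real.sin (b - a) := Real.sin_pos_of_pos_of_lt_pi (by linarith) (by linarith)
  have hx : ∀ x, b ≤ x → x ≤ a + Real.pi →
      inner ℝ (dir x) ξ * Real.sin (b - a)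
        = inner ℝ (dir b) ξ * Real.sin (x - a) - inner ℝ (dir a) ξ * Real.sin (x - b) ∧
      0 ≤ Real.sin (x - a) ∧ 0 ≤ Real.sin (x - b) := by
    intro x h1 h2
    refine ⟨?_, ?_, ?_⟩
    · have := inner_dir_mul_sin a b x ξ; linarith
    · exact Real.sin_nonneg_of_nonneg_of_le_pi (by linarith) (by linarith)
    · exact Real.sin_nonneg_of_nonneg_of_le_pi (by linarith) (by linarith)
  obtain ⟨hc1, hc2, hc3⟩ := hx c hbc (by linarith)
  obtain ⟨hd1, hd2, hd3⟩ := hx d (by linarith) hda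
  rcases mul_neg_iff.1 h with ⟨ha, hb⟩ | ⟨ha, hb⟩
  · refine mul_nonneg_of_nonpos_of_nonpos ?_ ?_
    · refine nonpos_of_mul_nonpos_left ?_ hs
      rw [hc1]; nlinarith [mul_nonneg ha.le hc3, mul_nonneg (neg_pos.2 hb).le hc2]
    · refine nonpos_of_mul_nonpos_left ?_ hs
      rw [hd1]; nlinarith [mul_nonneg ha.le hd3, mul_nonneg (neg_pos.2 hb).le hd2]
  · refine mul_nonneg ?_ ?_
    · refine nonneg_of_mul_nonneg_left ?_ hs
      rw [hc1]; nlinarith [mul_nonneg hb.le hc2, mul_nonneg (neg_pos.2 ha).le hc3]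
    · refine nonneg_of_mul_nonneg_left ?_ hs
      rw [hd1]; nlinarith [mul_nonneg hb.le hd2, mul_nonneg (neg_pos.2 ha).le hd3]

/-- Where the linear forms of the two ends of an arc have the same sign, the form of a direction in
the arc dominates that of one of the ends. -/
theorem exists_end_abs_inner_le {a b α : ℝ} (hab : a < b) (hba : b ≤ a + Real.pi)
    (hα : α ∈ Set.Icc a b) :
    ∃ t, (t = a ∨ t = b) ∧ ∀ ξ : Plane, 0 < inner ℝ (dir a) ξ * inner ℝ (dir b) ξ →
      |inner ℝ (dir t) ξ| ≤ 2 * |inner ℝ (dir α) ξ| := by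
  -- If the ends are antipodal, their forms never have the same sign and the claim is vacuous.
  rcases hba.eq_or_lt with h | h
  · refine ⟨a, Or.inl rfl, fun ξ hξ => absurd hξ (not_lt.2 ?_)⟩
    have : inner ℝ (dir b) ξ = -inner ℝ (dir a) ξ := by
      simp only [inner_dir, h, Real.cos_add_pi, Real.sin_add_pi]; ring
    rw [this]; nlinarith [sq_nonneg (inner ℝ (dir a) ξ)]
  · have hs : 0 < Real.sin (b - a) := Real.sin_pos_of_pos_of_lt_pi (by linarith) (by linarith)
    have hp : 0 ≤ Real.sin (b - α) :=
      Real.sin_nonneg_of_nonneg_of_le_pi (by linarith [hα.2]) (by linarith [hα.1])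
    have hq : 0 ≤ Real.sin (α - a) :=
      Real.sin_nonneg_of_nonneg_of_le_pi (by linarith [hα.1]) (by linarith [hα.2])
    have hsum : Real.sin (b - a) ≤ Real.sin (b - α) + Real.sin (α - a) := by
      have : b - a = (b - α) + (α - a) := by ring
      rw [this, Real.sin_add]
      nlinarith [Real.cos_le_one (α - a), Real.cos_le_one (b - α)]
    have habs : ∀ ξ : Plane, 0 < inner ℝ (dir a) ξ * inner ℝ (dir b) ξ →
        |inner ℝ (dir α) ξ| * Real.sin (b - a)
          = |inner ℝ (dir a) ξ| * Real.sin (b - α) + |inner ℝ (dir b) ξ| * Real.sin (α - a) := by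
      intro ξ hξ
      have h1 := inner_dir_mul_sin a α b ξ
      rw [← abs_of_pos hs, ← abs_mul, h1]
      rcases (mul_pos_iff.1 hξ) with ⟨h2, h3⟩ | ⟨h2, h3⟩
      · rw [abs_of_pos h2, abs_of_pos h3, abs_of_nonneg (by positivity)]
      · rw [abs_of_neg h2, abs_of_neg h3, abs_of_nonpos]
        · ring
        · nlinarith [mul_nonneg (neg_pos.2 h2).le hp, mul_nonneg (neg_pos.2 h3).le hq]
    -- The end with the larger coefficient is taken, so the choice depends on `α` but not on `ξ`;
    -- its coefficient is at least half of `sin (b - a)`.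
    rcases le_total (Real.sin (α - a)) (Real.sin (b - α)) with hle | hle
    · refine ⟨a, Or.inl rfl, fun ξ hξ => le_of_mul_le_mul_right ?_ hs⟩
      have h1 := habs ξ hξ
      have h2 := mul_nonneg (abs_nonneg (inner ℝ (dir b) ξ)) hq
      have h3 : |inner ℝ (dir a) ξ| * Real.sin (b - a)
          ≤ |inner ℝ (dir a) ξ| * (2 * Real.sin (b - α)) := by gcongr; linarith
      nlinarith
    · refine ⟨b, Or.inr rfl, fun ξ hξ => le_of_mul_le_mul_right ?_ hs⟩
      have h1 := habs ξ hξ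
      have h2 := mul_nonneg (abs_nonneg (inner ℝ (dir a) ξ)) hp
      have h3 : |inner ℝ (dir b) ξ| * Real.sin (b - a)
          ≤ |inner ℝ (dir b) ξ| * (2 * Real.sin (α - a)) := by gcongr; linarith
      nlinarith

/-- Lets the lines bounding a sector be discarded, so that off the sector the two forms have
strictly the same sign. -/
theorem ae_inner_dir_ne_zero (a : ℝ) : ∀ᵐ ξ : Plane, inner ℝ (dir a) ξ ≠ 0 := by
  have hne : (ℝ ∙ dir a)ᗮ ≠ ⊤ := by
    intro h
    have h1 : dir a ∈ (ℝ ∙ dir a)ᗮ := h ▸ Submodule.mem_top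
    rw [Submodule.mem_orthogonal_singleton_iff_inner_right, real_inner_self_eq_norm_sq,
      norm_dir] at h1
    norm_num at h1
  have h := Measure.addHaar_submodule volume (ℝ ∙ dir a)ᗮ hne
  refine measure_mono_null (fun ξ hξ => ?_) h
  simpa [Submodule.mem_orthogonal_singleton_iff_inner_right] using hξ

/-- The double sector of frequencies orthogonal to a direction strictly between `dir a` and
`dir b`. -/
def sector (a b : ℝ) : Set Plane := {ξ | inner ℝ (dir a) ξ * inner ℝ (dir b) ξ < 0}

theorem isOpen_sector (a b : ℝ) : IsOpen (sector a b) :=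
  isOpen_lt (by fun_prop) continuous_const

/-- Smooth frequency localization to an open set, up to a small integral error. -/
theorem exists_frequency_cutoff (f : 𝓢(Plane, ℂ)) {Γ : Set Plane} (hΓ : IsOpen Γ) {δ : ℝ≥0∞}
    (hδ : 0 < δ) :
    ∃ (g : 𝓢(Plane, ℂ)) (ρ : Plane → ℝ), (∀ ξ, 0 ≤ ρ ξ) ∧ (∀ ξ, ρ ξ ≤ 1) ∧ (∀ ξ ∉ Γ, ρ ξ = 0) ∧
      (∀ ξ, 𝓕 g ξ = (ρ ξ : ℂ) * 𝓕 f ξ) ∧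
      ∫⁻ ξ in Γ, ‖(1 - (ρ ξ : ℂ)) * 𝓕 f ξ‖ₑ ≤ δ := by
  obtain ⟨h, hsupp, hsm, hrange⟩ := hΓ.exists_contDiff_support_eq (n := ⊤)
  have h01 : ∀ ξ, 0 ≤ h ξ ∧ h ξ ≤ 1 := fun ξ => hrange ⟨ξ, rfl⟩
  let b : ∀ n : ℕ, ContDiffBump (0 : Plane) := fun n => ⟨n + 1, n + 2, by positivity, by linarith⟩
  -- As `h` is positive exactly on `Γ`, these smooth functions vanish off `Γ` and tend to one on it;
  -- the bump provides compact support.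
  let ρ : ℕ → Plane → ℝ := fun n ξ => b n ξ * (1 - (1 - h ξ) ^ n)
  have hpow0 : ∀ n ξ, 0 ≤ 1 - (1 - h ξ) ^ n := fun n ξ =>
    sub_nonneg.2 (pow_le_one₀ (sub_nonneg.2 (h01 ξ).2) (by linarith [(h01 ξ).1]))
  have hpow1 : ∀ n ξ, 1 - (1 - h ξ) ^ n ≤ 1 := fun n ξ =>
    sub_le_self _ (pow_nonneg (sub_nonneg.2 (h01 ξ).2) n)
  have hρ0 : ∀ n ξ, 0 ≤ ρ n ξ := fun n ξ => mul_nonneg (b n).nonneg (hpow0 n ξ)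
  have hρ1 : ∀ n ξ, ρ n ξ ≤ 1 := fun n ξ =>
    mul_le_one₀ (b n).le_one (hpow0 n ξ) (hpow1 n ξ)
  have hρs : ∀ n, ContDiff ℝ ∞ (ρ n) := fun n =>
    (b n).contDiff.mul (contDiff_const.sub ((contDiff_const.sub hsm).pow n))
  have hρlim : ∀ ξ ∈ Γ, Tendsto (fun n => ρ n ξ) atTop (𝓝 1) := by
    intro ξ hξ
    have hpos : 0 < h ξ := (h01 ξ).1.lt_of_ne' (by
      have : ξ ∈ Function.support h := hsupp ▸ hξ
      exact this)
    have h1 : Tendsto (fun n : ℕ => 1 - (1 - h ξ) ^ n) atTop (𝓝 (1 - 0)) :=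
      tendsto_const_nhds.sub (tendsto_pow_atTop_nhds_zero_of_lt_one
        (sub_nonneg.2 (h01 ξ).2) (by linarith))
    rw [sub_zero] at h1
    refine h1.congr' ?_
    obtain ⟨n, hn⟩ := exists_nat_ge ‖ξ‖
    filter_upwards [eventually_ge_atTop n] with m hm
    have : b m ξ = 1 := by
      refine (b m).one_of_mem_closedBall ?_
      rw [mem_closedBall_zero_iff]
      have : (n : ℝ) ≤ m := by exact_mod_cast hm
      change ‖ξ‖ ≤ (m : ℝ) + 1
      linarith
    simp [ρ, this]
  have hlim : Tendsto (fun n => ∫⁻ ξ in Γ, ‖(1 - (ρ n ξ : ℂ)) * 𝓕 f ξ‖ₑ) atTop (𝓝 0) := by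
    have h0 : (0 : ℝ≥0∞) = ∫⁻ ξ in Γ, 0 := by simp
    rw [h0]
    refine tendsto_lintegral_of_dominated_convergence (fun ξ => ‖𝓕 f ξ‖ₑ) ?_ ?_ ?_ ?_
    · intro n
      have h1 : Continuous fun ξ => (1 - (ρ n ξ : ℂ)) * 𝓕 f ξ := by
        have := (hρs n).continuous
        have := (𝓕 f).continuous
        fun_prop
      exact h1.measurable.enorm
    · intro n
      refine ae_of_all _ fun ξ => ?_
      rw [enorm_le_iff_norm_le, norm_mul, ← Complex.ofReal_one, ← Complex.ofReal_sub,
        Complex.norm_real, Real.norm_of_nonneg (sub_nonneg.2 (hρ1 n ξ))]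
      exact mul_le_of_le_one_left (norm_nonneg _) (sub_le_self _ (hρ0 n ξ))
    · exact ((𝓕 f).integrable.integrableOn (s := Γ)).2.ne
    · refine (ae_restrict_iff' hΓ.measurableSet).2 (ae_of_all _ fun ξ hξ => ?_)
      have h1 : Tendsto (fun n => (1 - (ρ n ξ : ℂ)) * 𝓕 f ξ) atTop (𝓝 ((1 - (1 : ℝ)) * 𝓕 f ξ)) :=
        (tendsto_const_nhds.sub
          ((Complex.continuous_ofReal.tendsto 1).comp (hρlim ξ hξ))).mul_const _
      simpa using h1.enorm
  obtain ⟨n, hn⟩ := (hlim.eventually_le_const hδ).exists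
  have hc : HasCompactSupport fun ξ => (ρ n ξ : ℂ) * 𝓕 f ξ :=
    (((b n).hasCompactSupport.mul_right).comp_left (g := fun t : ℝ => (t : ℂ)) (by simp)).mul_right
  have hs : ContDiff ℝ ∞ fun ξ => (ρ n ξ : ℂ) * 𝓕 f ξ :=
    (Complex.ofRealCLM.contDiff.comp (hρs n)).mul ((𝓕 f).smooth ⊤)
  refine ⟨𝓕⁻ (hc.toSchwartzMap hs), ρ n, hρ0 n, hρ1 n, fun ξ hξ => ?_, fun ξ => ?_, hn⟩
  · have : h ξ = 0 := by
      by_contra hne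
      exact hξ (hsupp ▸ (show ξ ∈ Function.support h from hne))
    simp [ρ, this]
  · simp

/-- The four terms stay together so that their symbols cancel before absolute values are taken. -/
theorem enorm_fourierInv_sub_le {F₁ F₂ F₃ F₄ : Plane → ℂ} (h₁ : Integrable F₁)
    (h₂ : Integrable F₂) (h₃ : Integrable F₃) (h₄ : Integrable F₄) (x : Plane) :
    ‖𝓕⁻ F₁ x - 𝓕⁻ F₂ x - (𝓕⁻ F₃ x - 𝓕⁻ F₄ x)‖ₑ
      ≤ ∫⁻ ξ, ‖F₁ ξ - F₂ ξ - (F₃ ξ - F₄ ξ)‖ₑ := by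
  have hmul : ∀ {F : Plane → ℂ}, Integrable F → Integrable fun ξ =>
      Complex.exp (↑(2 * Real.pi * inner ℝ ξ x) * Complex.I) • F ξ := by
    intro F hF
    refine hF.bdd_mul (c := 1) ?_ ?_
    · exact (by fun_prop : Continuous _).aestronglyMeasurable
    · exact ae_of_all _ fun p => (Complex.norm_exp_ofReal_mul_I _).le
  simp only [Real.fourierInv_eq']
  have h₁₂ := (hmul h₁).sub (hmul h₂)
  have h₃₄ := (hmul h₃).sub (hmul h₄)
  simp only [Pi.sub_def] at h₁₂ h₃₄
  rw [← integral_sub (hmul h₁) (hmul h₂), ← integral_sub (hmul h₃) (hmul h₄),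
    ← integral_sub h₁₂ h₃₄]
  refine (enorm_integral_le_lintegral_enorm _).trans (lintegral_mono fun ξ => ?_)
  simp only [← smul_sub]
  rw [enorm_smul, ← ofReal_norm (Complex.exp _), Complex.norm_exp_ofReal_mul_I]
  simp

/-- A direction in an arc sees, up to two parameter averages and a small error, only the
frequencies in the sector of the arc. -/
theorem exists_end_enorm_avg_le {φ χ : 𝓢(ℝ, ℝ)} (hφ : IsCutoff φ)
    (hχ : ∀ t, |t| ≤ (2 : ℝ) ^ (-7 : ℤ) → χ t = 1) (hχ0 : ∀ t, 0 ≤ χ t) (hχ1 : ∀ t, χ t ≤ 1)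
    {a b : ℝ} (hab : a < b) (hba : b ≤ a + Real.pi) {v : Plane} (hv : v ∈ arc a b) :
    ∃ u, (u = dir a ∨ u = dir b) ∧ ∀ (s : ℝ) (f g : 𝓢(Plane, ℂ)) (ρ : Plane → ℝ),
      (∀ ξ, 𝓕 g ξ = (ρ ξ : ℂ) * 𝓕 f ξ) → ∀ x,
        ‖avg φ v s f x‖ₑ ≤ ‖avg φ v s g x‖ₑ + (‖mixedAvg φ χ u v s f x‖ₑ
          + ‖mixedAvg φ χ u v s g x‖ₑ) + ENNReal.ofReal (SchwartzMap.seminorm ℝ 0 0 φ)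
          * ∫⁻ ξ in sector a b, ‖(1 - (ρ ξ : ℂ)) * 𝓕 f ξ‖ₑ := by
  obtain ⟨α, hα, rfl⟩ := hv
  obtain ⟨t, ht, hle⟩ := exists_end_abs_inner_le hab hba hα
  refine ⟨dir t, ht.imp (congrArg dir) (congrArg dir), fun s f g ρ hg x => ?_⟩
  have hint1 : ∀ h : 𝓢(Plane, ℂ), Integrable fun η : Plane =>
      ((φ (s * (2 * Real.pi * inner ℝ (dir α) η)) : ℝ) : ℂ) * 𝓕 (h : Plane → ℂ) η := by
    intro h
    have := integrable_line_mul (toComplex φ) ((2 * Real.pi * s) • dir α) (𝓕 h).integrable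
    simp only [← scaled_inner, toComplex_apply] at this
    exact this
  have hint2 : ∀ h : 𝓢(Plane, ℂ), Integrable fun η : Plane =>
      ((φ (s * (2 * Real.pi * inner ℝ (dir α) η)) : ℝ) : ℂ) *
        (((χ (s * (2 * Real.pi * inner ℝ (dir t) η)) : ℝ) : ℂ) * 𝓕 (h : Plane → ℂ) η) := by
    intro h
    have := integrable_line_mul (toComplex φ) ((2 * Real.pi * s) • dir α)
      (integrable_line_mul (toComplex χ) ((2 * Real.pi * s) • dir t) (𝓕 h).integrable)
    simp only [← scaled_inner, toComplex_apply] at this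
    exact this
  have herr : ‖avg φ (dir α) s f x - avg φ (dir α) s g x
      - (mixedAvg φ χ (dir t) (dir α) s f x - mixedAvg φ χ (dir t) (dir α) s g x)‖ₑ
      ≤ ENNReal.ofReal (SchwartzMap.seminorm ℝ 0 0 φ)
          * ∫⁻ ξ in sector a b, ‖(1 - (ρ ξ : ℂ)) * 𝓕 f ξ‖ₑ := by
    refine (enorm_fourierInv_sub_le (hint1 f) (hint1 g) (hint2 f) (hint2 g) x).trans ?_
    rw [← lintegral_const_mul' _ _ (by simp), ← lintegral_indicator (isOpen_sector a b).measurableSet]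
    refine lintegral_mono_ae ?_
    filter_upwards [ae_inner_dir_ne_zero a, ae_inner_dir_ne_zero b] with ξ ha hb
    -- The combined symbol factors as `φ (1 - χ)` times `1 - ρ`: the first factor vanishes almost
    -- everywhere off the sector, the second makes the integral over the sector small.
    have e1 : ((φ (s * (2 * Real.pi * inner ℝ (dir α) ξ)) : ℝ) : ℂ) * 𝓕 (f : Plane → ℂ) ξ
        - ((φ (s * (2 * Real.pi * inner ℝ (dir α) ξ)) : ℝ) : ℂ) * 𝓕 (g : Plane → ℂ) ξ
        - (((φ (s * (2 * Real.pi * inner ℝ (dir α) ξ)) : ℝ) : ℂ) *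
          (((χ (s * (2 * Real.pi * inner ℝ (dir t) ξ)) : ℝ) : ℂ) * 𝓕 (f : Plane → ℂ) ξ)
        - ((φ (s * (2 * Real.pi * inner ℝ (dir α) ξ)) : ℝ) : ℂ) *
          (((χ (s * (2 * Real.pi * inner ℝ (dir t) ξ)) : ℝ) : ℂ) * 𝓕 (g : Plane → ℂ) ξ))
        = ((φ (s * (2 * Real.pi * inner ℝ (dir α) ξ))
            * (1 - χ (s * (2 * Real.pi * inner ℝ (dir t) ξ))) : ℝ) : ℂ)
          * ((1 - (ρ ξ : ℂ)) * 𝓕 f ξ) := by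
      have hgξ : 𝓕 (g : Plane → ℂ) ξ = (ρ ξ : ℂ) * 𝓕 f ξ := hg ξ
      have hfξ : 𝓕 (f : Plane → ℂ) ξ = 𝓕 f ξ := rfl
      rw [hgξ, hfξ]
      push_cast
      ring
    rw [e1, enorm_mul]
    by_cases hξ : ξ ∈ sector a b
    · rw [Set.indicator_of_mem hξ]
      gcongr
      rw [← ofReal_norm, Complex.norm_real, norm_mul]
      refine ENNReal.ofReal_le_ofReal ?_
      refine (mul_le_of_le_one_right (norm_nonneg _) ?_).trans (SchwartzMap.norm_le_seminorm ℝ φ _)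
      rw [Real.norm_of_nonneg (sub_nonneg.2 (hχ1 _))]
      exact sub_le_self _ (hχ0 _)
    · rw [Set.indicator_of_notMem hξ]
      have hpos : 0 < inner ℝ (dir a) ξ * inner ℝ (dir b) ξ :=
        (not_lt.1 hξ).lt_of_ne' (mul_ne_zero ha hb)
      -- On the support of `φ` the argument is at most `2⁻⁸`; the factor 2 lost in passing to the
      -- end of the arc gives `2⁻⁷`, where `χ = 1`.
      have hzero : φ (s * (2 * Real.pi * inner ℝ (dir α) ξ))
          * (1 - χ (s * (2 * Real.pi * inner ℝ (dir t) ξ))) = 0 := by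
        by_cases hφ0 : φ (s * (2 * Real.pi * inner ℝ (dir α) ξ)) = 0
        · rw [hφ0, zero_mul]
        · have h1 := hφ.support (subset_tsupport _ hφ0)
          rw [mem_closedBall_zero_iff, Real.norm_eq_abs] at h1
          rw [hχ, sub_self, mul_zero]
          calc |s * (2 * Real.pi * inner ℝ (dir t) ξ)|
              = |s * (2 * Real.pi)| * |inner ℝ (dir t) ξ| := by rw [← abs_mul]; ring_nf
            _ ≤ |s * (2 * Real.pi)| * (2 * |inner ℝ (dir α) ξ|) := by gcongr; exact hle ξ hpos
            _ = 2 * |s * (2 * Real.pi * inner ℝ (dir α) ξ)| := by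
                rw [mul_left_comm, ← abs_mul]; ring_nf
            _ ≤ 2 * (2 : ℝ) ^ (-8 : ℤ) := by gcongr
            _ = _ := by norm_num
      rw [hzero]
      simp
  calc ‖avg φ (dir α) s f x‖ₑ
      = ‖avg φ (dir α) s g x + (mixedAvg φ χ (dir t) (dir α) s f x
          - mixedAvg φ χ (dir t) (dir α) s g x)
          + (avg φ (dir α) s f x - avg φ (dir α) s g x
            - (mixedAvg φ χ (dir t) (dir α) s f x - mixedAvg φ χ (dir t) (dir α) s g x))‖ₑ := by
        congr 1; ring
    _ ≤ _ := by
        refine (enorm_add_le _ _).trans (add_le_add ((enorm_add_le _ _).trans ?_) herr)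
        gcongr
        exact enorm_sub_le

end

/-! ### Almost orthogonality and summation over the arcs. -/

theorem eLpNorm_two_sq {α E : Type*} [MeasurableSpace α] [TopologicalSpace E]
    [ContinuousENorm E] (F : α → E) (μ : Measure α) :
    eLpNorm F 2 μ ^ 2 = ∫⁻ x, ‖F x‖ₑ ^ 2 ∂μ := by
  rw [eLpNorm_eq_lintegral_rpow_enorm_toReal (by norm_num) (by norm_num), ← ENNReal.rpow_natCast,
    ← ENNReal.rpow_mul]
  simp

theorem eLpNorm_two_sq_ennreal {α : Type*} [MeasurableSpace α] (F : α → ℝ≥0∞) (μ : Measure α) :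
    eLpNorm F 2 μ ^ 2 = ∫⁻ x, F x ^ 2 ∂μ := by
  simp [eLpNorm_two_sq]

/-- A finite operator norm is attained as a bound. -/
theorem lintegral_maxAvg_sq_le {φ : 𝓢(ℝ, ℝ)} {V : Set Plane} {S : Set ℝ}
    (h : opNorm φ V S ≠ ∞) (f : 𝓢(Plane, ℂ)) :
    ∫⁻ x, maxAvg φ V S f x ^ 2 ≤ opNorm φ V S ^ 2 * ∫⁻ x, ‖f x‖ₑ ^ 2 := by
  have key : eLpNorm (maxAvg φ V S f) 2 volume
      ≤ opNorm φ V S * eLpNorm (f : Plane → ℂ) 2 volume := by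
    have hft : eLpNorm (f : Plane → ℂ) 2 volume ≠ ∞ := (f.eLpNorm_lt_top 2 volume).ne
    rcases eq_or_ne (eLpNorm (f : Plane → ℂ) 2 volume) 0 with h0 | h0
    · obtain ⟨B, hB, -⟩ := sInf_lt_iff.1 (lt_top_iff_ne_top.2 h)
      have := hB f
      rw [h0, mul_zero] at this ⊢
      exact this
    · rw [← ENNReal.div_le_iff h0 hft]
      exact le_sInf fun B hB => (ENNReal.div_le_iff h0 hft).2 (hB f)
  rw [← eLpNorm_two_sq_ennreal, ← eLpNorm_two_sq, ← mul_pow]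
  exact pow_le_pow_left' key 2

theorem lintegral_enorm_sq_eq (f : 𝓢(Plane, ℂ)) :
    ∫⁻ x, ‖f x‖ₑ ^ 2 = ENNReal.ofReal (∫ x, ‖f x‖ ^ 2) := by
  have h := (f.memLp 2 (volume : Measure Plane)).integrable_norm_pow (p := 2) (by norm_num)
  rw [ofReal_integral_eq_lintegral_ofReal h (ae_of_all _ fun x => by positivity)]
  refine lintegral_congr fun x => ?_
  rw [ENNReal.ofReal_pow (norm_nonneg _), ofReal_norm]

theorem lintegral_fourier_sq (f : 𝓢(Plane, ℂ)) :
    ∫⁻ ξ, ‖𝓕 f ξ‖ₑ ^ 2 = ∫⁻ x, ‖f x‖ₑ ^ 2 := by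
  rw [lintegral_enorm_sq_eq, lintegral_enorm_sq_eq, SchwartzMap.integral_norm_sq_fourier]

/-- Frequency localizations to disjoint sets are almost orthogonal. -/
theorem sum_lintegral_sq_le {ι : Type*} [Fintype ι] (f : 𝓢(Plane, ℂ)) (g : ι → 𝓢(Plane, ℂ))
    (ρ : ι → Plane → ℝ) (Γ : ι → Set Plane) (hΓ : Pairwise fun i j => Disjoint (Γ i) (Γ j))
    (hρ0 : ∀ i ξ, 0 ≤ ρ i ξ) (hρ1 : ∀ i ξ, ρ i ξ ≤ 1) (hρ : ∀ i, ∀ ξ ∉ Γ i, ρ i ξ = 0)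
    (hg : ∀ i ξ, 𝓕 (g i) ξ = (ρ i ξ : ℂ) * 𝓕 f ξ) :
    ∑ i, ∫⁻ x, ‖g i x‖ₑ ^ 2 ≤ ∫⁻ x, ‖f x‖ₑ ^ 2 := by
  rw [← lintegral_fourier_sq f,
    Finset.sum_congr rfl fun i _ => (lintegral_fourier_sq (g i)).symm]
  rw [← lintegral_finsetSum' _ fun i _ =>
    ((𝓕 (g i)).continuous.measurable.enorm.pow_const 2).aemeasurable]
  refine lintegral_mono fun ξ => ?_
  have hle : ∀ i, ‖𝓕 (g i) ξ‖ₑ ^ 2 ≤ ‖𝓕 f ξ‖ₑ ^ 2 := by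
    intro i
    refine pow_le_pow_left' ?_ 2
    rw [hg, enorm_le_iff_norm_le, norm_mul, Complex.norm_real, Real.norm_of_nonneg (hρ0 i ξ)]
    exact mul_le_of_le_one_left (norm_nonneg _) (hρ1 i ξ)
  by_cases h : ∃ i, ξ ∈ Γ i
  · obtain ⟨i, hi⟩ := h
    rw [Finset.sum_eq_single_of_mem i (Finset.mem_univ i)]
    · exact hle i
    · intro j _ hji
      rw [hg, hρ j ξ (fun hj => (hΓ hji).le_bot ⟨hj, hi⟩)]
      simp
  · push Not at h
    rw [Finset.sum_eq_zero fun i _ => by rw [hg, hρ i ξ (h i)]; simp]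
    exact zero_le

/-- A common frequency would make its linear form change sign twice within a half circle. -/
theorem disjoint_sector {N : ℕ} {θ : Fin (N + 1) → ℝ} (hθ : StrictMono θ)
    (hθπ : θ (Fin.last N) ≤ θ 0 + Real.pi) :
    Pairwise fun i j : Fin N => Disjoint (sector (θ i.castSucc) (θ i.succ))
      (sector (θ j.castSucc) (θ j.succ)) := by
  have key : ∀ i j : Fin N, i < j → Disjoint (sector (θ i.castSucc) (θ i.succ))
      (sector (θ j.castSucc) (θ j.succ)) := by
    intro i j hij
    refine Set.disjoint_left.2 fun ξ hi hj => ?_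
    refine absurd hj (not_lt.2 (inner_dir_sign_change (hθ i.castSucc_lt_succ) (hθ.monotone ?_)
      (hθ j.castSucc_lt_succ) ?_ hi))
    · rw [Fin.succ_le_castSucc_iff]; exact hij
    · have h1 := hθ.monotone (Fin.le_last j.succ)
      have h2 := hθ.monotone (Fin.zero_le i.castSucc)
      linarith
  intro i j hij
  rcases lt_or_gt_of_ne hij with h | h
  · exact key i j h
  · exact (key j i h).symm

/-- A smooth function on the line which is one near the origin. -/
theorem exists_cutoff_eq_one {r : ℝ} (hr : 0 < r) :
    ∃ χ : 𝓢(ℝ, ℝ), (∀ t, |t| ≤ r → χ t = 1) ∧ (∀ t, 0 ≤ χ t) ∧ ∀ t, χ t ≤ 1 := by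
  let b : ContDiffBump (0 : ℝ) := ⟨r, 2 * r, hr, by linarith⟩
  refine ⟨b.hasCompactSupport.toSchwartzMap b.contDiff, fun t ht => ?_, fun t => b.nonneg,
    fun t => b.le_one⟩
  exact b.one_of_mem_closedBall (by simpa using ht)

/-- The `ℓ²` sum of finitely many functions. -/
def sqSum {ι α : Type*} [Fintype ι] (F : ι → α → ℝ≥0∞) (x : α) : ℝ≥0∞ :=
  (∑ i, F i x ^ 2) ^ (1 / 2 : ℝ)

theorem le_sqSum {ι α : Type*} [Fintype ι] (F : ι → α → ℝ≥0∞) (i : ι) (x : α) :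
    F i x ≤ sqSum F x := by
  rw [sqSum, one_div, ENNReal.le_rpow_inv_iff (by norm_num)]
  refine le_trans (le_of_eq ?_)
    (Finset.single_le_sum (f := fun i => F i x ^ 2) (fun _ _ => zero_le) (Finset.mem_univ i))
  norm_num

theorem measurable_sqSum {ι α : Type*} [Fintype ι] [MeasurableSpace α] {F : ι → α → ℝ≥0∞}
    (hF : ∀ i, Measurable (F i)) : Measurable (sqSum F) :=
  (Finset.measurable_fun_sum _ fun i _ => (hF i).pow_const 2).pow_const _

theorem eLpNorm_sqSum_sq {ι α : Type*} [Fintype ι] [MeasurableSpace α] {F : ι → α → ℝ≥0∞}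
    (hF : ∀ i, Measurable (F i)) (μ : Measure α) :
    eLpNorm (sqSum F) 2 μ ^ 2 = ∑ i, ∫⁻ x, F i x ^ 2 ∂μ := by
  rw [eLpNorm_two_sq_ennreal, ← lintegral_finsetSum' _ fun i _ => ((hF i).pow_const 2).aemeasurable]
  refine lintegral_congr fun x => ?_
  rw [sqSum, ← ENNReal.rpow_natCast, ← ENNReal.rpow_mul]
  norm_num

/-- The localization error is a pointwise constant, square integrable only on sets of finite
measure; hence the passage through balls. -/
theorem eLpNorm_le_of_forall_ball {F : Plane → ℝ≥0∞} {B : ℝ≥0∞}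
    (h : ∀ n : ℕ, eLpNorm F 2 (volume.restrict (Metric.ball 0 n)) ≤ B) (hF : Measurable F) :
    eLpNorm F 2 volume ≤ B := by
  rw [← ENNReal.pow_le_pow_left_iff two_ne_zero, eLpNorm_two_sq_ennreal]
  have hcover : AECover (volume : Measure Plane) atTop fun n : ℕ => Metric.ball (0 : Plane) n :=
    aecover_ball tendsto_natCast_atTop_atTop
  refine le_of_tendsto' (hcover.lintegral_tendsto_of_nat (hF.pow_const 2).aemeasurable)
    fun n => ?_
  rw [← eLpNorm_two_sq_ennreal]
  exact pow_le_pow_left' (h n) 2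

/-- The almost orthogonality principle on a set of finite measure, for finite operator norms. -/
theorem eLpNorm_maxAvg_iUnion_le {φ χ : 𝓢(ℝ, ℝ)} (hφ : IsCutoff φ)
    (hχ : ∀ t, |t| ≤ (2 : ℝ) ^ (-7 : ℤ) → χ t = 1) (hχ0 : ∀ t, 0 ≤ χ t) (hχ1 : ∀ t, χ t ≤ 1)
    {S : Set ℝ} {N : ℕ} {θ : Fin (N + 1) → ℝ} (hθ : StrictMono θ)
    (hθπ : θ (Fin.last N) ≤ θ 0 + Real.pi) {V : Fin N → Set Plane}
    (hV : ∀ j : Fin N, V j ⊆ arc (θ j.castSucc) (θ j.succ)) {L M : ℝ≥0∞}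
    (hL : ∀ f : 𝓢(Plane, ℂ), ∃ Q : Plane → ℝ≥0∞, Measurable Q ∧
      ∫⁻ x, Q x ^ 2 ≤ L ^ 2 * ∫⁻ x, ‖f x‖ₑ ^ 2 ∧
      ∀ i, ∀ v, ‖v‖ = 1 → ∀ s ∈ S, ∀ x, ‖mixedAvg φ χ (dir (θ i)) v s f x‖ₑ ≤ Q x)
    (hM : ∀ j, ∀ f : 𝓢(Plane, ℂ), ∫⁻ x, maxAvg φ (V j) S f x ^ 2 ≤ M ^ 2 * ∫⁻ x, ‖f x‖ₑ ^ 2)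
    (f : 𝓢(Plane, ℂ)) {B : Set Plane} (hB : volume B ≠ ∞) :
    eLpNorm (maxAvg φ (⋃ j, V j) S f) 2 (volume.restrict B)
      ≤ (2 * L + M) * eLpNorm (f : Plane → ℂ) 2 volume := by
  set E := eLpNorm (f : Plane → ℂ) 2 volume with hE
  set k := ENNReal.ofReal (SchwartzMap.seminorm ℝ 0 0 φ) with hk
  set m := volume B ^ (1 / 2 : ℝ) with hm
  have hkm : k * m ≠ ∞ :=
    ENNReal.mul_ne_top ENNReal.ofReal_ne_top (ENNReal.rpow_ne_top_of_nonneg (by norm_num) hB)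
  refine ENNReal.le_of_forall_pos_le_add fun ε hε _ => ?_
  -- Makes the constant error `k * δ` have norm at most `ε` on `B`; the added 1 avoids a zero
  -- denominator.
  set δ : ℝ≥0∞ := ε / (k * m + 1) with hδ
  have hδ0 : 0 < δ := ENNReal.div_pos (by exact_mod_cast hε.ne') (by simp [hkm])
  choose g ρ hρ0 hρ1 hρ hg herr using fun j : Fin N =>
    exists_frequency_cutoff f (isOpen_sector (θ j.castSucc) (θ j.succ)) hδ0
  have horth := sum_lintegral_sq_le f g ρ _ (disjoint_sector hθ hθπ) hρ0 hρ1 hρ hg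
  obtain ⟨Qf, hQfm, hQf2, hQf⟩ := hL f
  choose Qg hQgm hQg2 hQg using fun j => hL (g j)
  -- The supremum over `j` is enlarged to an `ℓ²` sum, whose norm is at most `M * E` with no loss,
  -- by orthogonality of the pieces.
  let P₁ : Plane → ℝ≥0∞ := sqSum fun j => maxAvg φ (V j) S (g j)
  let P₂ : Plane → ℝ≥0∞ := sqSum Qg
  have hP₁m : Measurable P₁ := measurable_sqSum fun j => measurable_maxAvg φ (V j) S (g j)
  have hP₂m : Measurable P₂ := measurable_sqSum hQgm
  have hpt : ∀ x, maxAvg φ (⋃ j, V j) S f x ≤ P₁ x + (Qf x + P₂ x) + k * δ := by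
    intro x
    refine iSup₂_le fun v hv => iSup₂_le fun s hs => ?_
    obtain ⟨j, hvj⟩ := Set.mem_iUnion.1 hv
    have hv1 : ‖v‖ = 1 := by
      obtain ⟨α, -, rfl⟩ := hV j hvj
      exact norm_dir α
    have hπ : θ j.succ ≤ θ j.castSucc + Real.pi := by
      have h1 := hθ.monotone (Fin.le_last j.succ)
      have h2 := hθ.monotone (Fin.zero_le j.castSucc)
      linarith
    obtain ⟨u, hu, hle⟩ := exists_end_enorm_avg_le hφ hχ hχ0 hχ1 (hθ j.castSucc_lt_succ) hπ
      (hV j hvj)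
    have hui : ∃ i, u = dir (θ i) := hu.elim (fun h => ⟨_, h⟩) fun h => ⟨_, h⟩
    obtain ⟨i, rfl⟩ := hui
    refine (hle s f (g j) (ρ j) (hg j) x).trans ?_
    refine add_le_add (add_le_add ?_ (add_le_add (hQf i v hv1 s hs x) ?_))
      (mul_le_mul_right (herr j) _)
    · refine le_trans ?_ (le_sqSum (fun j => maxAvg φ (V j) S (g j)) j x)
      exact le_iSup₂_of_le v hvj (le_iSup₂_of_le s hs le_rfl)
    · exact (hQg j i v hv1 s hs x).trans (le_sqSum Qg j x)
  have hE2 : E ^ 2 = ∫⁻ x, ‖f x‖ₑ ^ 2 := eLpNorm_two_sq _ _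
  have hP₁ : eLpNorm P₁ 2 (volume.restrict B) ≤ M * E := by
    refine (eLpNorm_mono_measure P₁ Measure.restrict_le_self).trans ?_
    rw [← ENNReal.pow_le_pow_left_iff two_ne_zero, mul_pow, hE2,
      eLpNorm_sqSum_sq fun j => measurable_maxAvg φ (V j) S (g j)]
    calc ∑ j, ∫⁻ x, maxAvg φ (V j) S (g j) x ^ 2 ≤ ∑ j, M ^ 2 * ∫⁻ x, ‖g j x‖ₑ ^ 2 :=
          Finset.sum_le_sum fun j _ => hM j (g j)
      _ ≤ _ := by rw [← Finset.mul_sum]; gcongr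
  have hP₂ : eLpNorm P₂ 2 (volume.restrict B) ≤ L * E := by
    refine (eLpNorm_mono_measure P₂ Measure.restrict_le_self).trans ?_
    rw [← ENNReal.pow_le_pow_left_iff two_ne_zero, mul_pow, hE2, eLpNorm_sqSum_sq hQgm]
    calc ∑ j, ∫⁻ x, Qg j x ^ 2 ≤ ∑ j, L ^ 2 * ∫⁻ x, ‖g j x‖ₑ ^ 2 :=
          Finset.sum_le_sum fun j _ => hQg2 j
      _ ≤ _ := by rw [← Finset.mul_sum]; gcongr
  have hQ : eLpNorm Qf 2 (volume.restrict B) ≤ L * E := by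
    refine (eLpNorm_mono_measure Qf Measure.restrict_le_self).trans ?_
    rw [← ENNReal.pow_le_pow_left_iff two_ne_zero, mul_pow, hE2, eLpNorm_two_sq_ennreal]
    exact hQf2
  have hconst : eLpNorm (fun _ : Plane => k * δ) 2 (volume.restrict B) ≤ ε := by
    rw [eLpNorm_const' _ (by norm_num) (by norm_num)]
    simp only [enorm_eq_self, Measure.restrict_apply MeasurableSet.univ, Set.univ_inter,
      ENNReal.toReal_ofNat]
    calc k * δ * m = k * m * δ := by ring
      _ ≤ (k * m + 1) * δ := by gcongr; exact le_self_add
      _ ≤ ε := ENNReal.mul_div_le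
  calc eLpNorm (maxAvg φ (⋃ j, V j) S f) 2 (volume.restrict B)
      ≤ eLpNorm (P₁ + (Qf + P₂) + fun _ => k * δ) 2 (volume.restrict B) := by
        refine eLpNorm_mono_enorm fun x => ?_
        simpa using hpt x
    _ ≤ (M * E + (L * E + L * E)) + ε := by
        refine (eLpNorm_add_le (by fun_prop) (by fun_prop) (by norm_num)).trans
          (add_le_add ?_ hconst)
        refine (eLpNorm_add_le (by fun_prop) (by fun_prop) (by norm_num)).trans
          (add_le_add hP₁ ?_)
        exact (eLpNorm_add_le (by fun_prop) (by fun_prop) (by norm_num)).trans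
          (add_le_add hQ hP₂)
    _ = _ := by ring

end

end DirectionalAverages


open DirectionalAverages

theorem theorem3p1 (φ : 𝓢(ℝ, ℝ)) (hφ : DirectionalAverages.IsCutoff φ) :
    ∃ C : ℝ≥0, ∀ (S : Set ℝ), S ⊆ Set.Ioi 0 →
      ∀ (N : ℕ) (θ : Fin (N + 1) → ℝ), StrictMono θ → θ (Fin.last N) ≤ θ 0 + Real.pi →
      ∀ V : Fin N → Set DirectionalAverages.Plane,
        (∀ j : Fin N, V j ⊆ DirectionalAverages.arc (θ j.castSucc) (θ j.succ)) →
        DirectionalAverages.opNorm φ (⋃ j, V j) S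
          ≤ C * DirectionalAverages.opNorm φ
                (Set.range fun i => DirectionalAverages.dir (θ i)) S
            + ⨆ j, DirectionalAverages.opNorm φ (V j) S := by
  obtain ⟨χ, hχ, hχ0, hχ1⟩ := exists_cutoff_eq_one (r := (2 : ℝ) ^ (-7 : ℤ)) (by positivity)
  obtain ⟨c, hc⟩ := exists_mixedAvg_majorant hφ.even hφ.zero_ne χ
  -- The factor 2 counts the mixed averages of `f` and those of its pieces. The added 1 keeps the
  -- constant nonzero, so that an infinite norm over `U` makes the right side infinite.
  refine ⟨2 * NNReal.sqrt c + 1, fun S _ N θ hθ hθπ V hV => ?_⟩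
  set U := Set.range fun i => dir (θ i) with hU
  set M := ⨆ j, opNorm φ (V j) S with hM
  rcases eq_or_ne (opNorm φ U S) ∞ with hUt | hUt
  · rw [hUt, ENNReal.mul_top (by positivity), top_add]
    exact le_top
  rcases eq_or_ne M ∞ with hMt | hMt
  · rw [hMt, add_top]
    exact le_top
  have hMj : ∀ j, ∀ f : 𝓢(Plane, ℂ),
      ∫⁻ x, maxAvg φ (V j) S f x ^ 2 ≤ M ^ 2 * ∫⁻ x, ‖f x‖ₑ ^ 2 := by
    intro j f
    have hj : opNorm φ (V j) S ≤ M := le_iSup (fun j => opNorm φ (V j) S) j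
    exact (lintegral_maxAvg_sq_le (ne_top_of_le_ne_top hMt hj) f).trans (by gcongr)
  have hL : ∀ f : 𝓢(Plane, ℂ), ∃ Q : Plane → ℝ≥0∞, Measurable Q ∧
      ∫⁻ x, Q x ^ 2 ≤ (NNReal.sqrt c * opNorm φ U S) ^ 2 * ∫⁻ x, ‖f x‖ₑ ^ 2 ∧
      ∀ i, ∀ v, ‖v‖ = 1 → ∀ s ∈ S, ∀ x, ‖mixedAvg φ χ (dir (θ i)) v s f x‖ₑ ≤ Q x := by
    intro f
    obtain ⟨Q, hQm, hQ2, hQ⟩ := hc U S (opNorm φ U S ^ 2)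
      (by rintro u ⟨i, rfl⟩; exact norm_dir _) (lintegral_maxAvg_sq_le hUt) f
    refine ⟨Q, hQm, ?_, fun i => hQ _ ⟨i, rfl⟩⟩
    rw [mul_pow, ← ENNReal.coe_pow, NNReal.sq_sqrt]
    exact hQ2
  refine sInf_le fun f => ?_
  calc eLpNorm (maxAvg φ (⋃ j, V j) S f) 2 volume
      ≤ (2 * (NNReal.sqrt c * opNorm φ U S) + M) * eLpNorm (f : Plane → ℂ) 2 volume :=
        eLpNorm_le_of_forall_ball (fun n => eLpNorm_maxAvg_iUnion_le hφ hχ hχ0 hχ1 hθ hθπ hV hL hMj f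
          Metric.isBounded_ball.measure_lt_top.ne) (measurable_maxAvg _ _ _ _)
    _ ≤ _ := by
        rw [← mul_assoc]
        gcongr
        push_cast
        exact le_self_add
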